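/- All simplicial complexes are finite and abstract, contain the empty face, and are considered up to isomorphism. For a finite set $\alpha$ let $\overline{\alpha}$ (resp. $\partial\alpha$) be the complex of all subsets (resp. all proper subsets) of $\alpha$, let $*$ denote the join, and for a complex $X$ with vertex set $V(X)$ let $X[A]=\{s\in X: s\subseteq A\}$. A bistellar move $\alpha\mapsto\beta$ of index $i$ on a $d$-dimensional complex $X$, where $\alpha,\beta$ are disjoint non-empty sets with $\#\beta=i+1$, $\#\alpha+\#\beta=d+2$ and $X[\alpha\cup\beta]=\overline{\alpha}*\partial\beta$, replaces $X$ by $(X\setminus(\overline{\alpha}*\partial\beta))\cup(\partial\alpha*\overline{\beta})$. A $d$-dimensional complex is $k$-stellated if it is obtained from the boundary complex of a simplex with $d+2$ vertices by finitely many bistellar moves, each of index $<k$ (such a complex is a triangulated $d$-sphere). Let $\mathbb F$ be any field. For a complex $X$ let $\widetilde\beta_i(X)=\dim_{\mathbb F}H_i(X;\mathbb F)-\delta_{i0}$ (so $\widetilde\beta_0(\{\emptyset\})=-1$), and for $X$ with $m$ vertices put $$\sigma_i(X)=\sum_{j=0}^{m}\frac{1}{\binom mj}\sum_{A\subseteq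 V(X),\ \#A=j}\widetilde\beta_i(X[A]).$$ For $X$ of dimension $d$ with $f_i$ faces of dimension $i$ ($f_{-1}=1$) put $$g_j(X)=\sum_{i=-1}^{j-1}(-1)^{j-i-1}\binom{d-i+1}{j-i-1}f_i,\qquad 0\le j\le d+1.$$ **Theorem.** Let $k\ge 1$ and let $S$ be an $m$-vertex $k$-stellated sphere of dimension $d\ge 2k-1$. Then, with respect to any field $\mathbb F$, $\sigma_i=\sigma_i(S)$ and $g_i=g_i(S)$ satisfy: (a) $\sigma_i=0$ for $k\le i\le d-k-1$; (b) $\displaystyle\sum_{i=0}^{l}(-1)^{l-i}\sigma_i\le\frac{m+1}{d+3}\sum_{i=0}^{l+1}(-1)^{l+1-i}\frac{g_i}{\binom{d+2}{i}}$ for $0\le l\le k-2$; (c) $\displaystyle\sum_{i=0}^{l}(-1)^{l-i}\sigma_i=\frac{m+1}{d+3}\sum_{i=0}^{l+1}(-1)^{l+1-i}\frac{g_i}{\binom{d+2}{i}}$ for $k-1\le l\le d-k-1$. -/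

import Mathlib

set_option maxSynthPendingDepth 3

/-- A finite abstract simplicial complex with vertices in `V`: a finite, downward closed family of
finite sets (the faces).  The empty set is a face of every complex; this convention (which differs
from the one of `PreAbstractSimplicialComplex`) is the one under which joins are formed and under
which the number of `(-1)`-dimensional faces is `1`. -/
@[ext]
structure FinComplex (V : Type*) where
  /-- the faces of the complex, the empty face included -/
  faces : Finset (Finset V)
  empty_mem : ∅ ∈ faces
  down_closed : ∀ s ∈ faces, ∀ t, t ⊆ s → t ∈ faces

namespace FinComplex

section Combinatorics

variable {V W : Type*} [DecidableEq V] [DecidableEq W]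

/-- The vertex set `V(X)`: since faces are downward closed, it is the union of the faces. -/
def vertices (X : FinComplex V) : Finset V := X.faces.biUnion id

/-- The induced subcomplex `X[A] = {s ∈ X : s ⊆ A}`. -/
def induced (X : FinComplex V) (A : Finset V) : FinComplex V where
  faces := X.faces.filter (fun s => s ⊆ A)
  empty_mem := by simp [X.empty_mem]
  down_closed := by
    intro s hs t hts
    rw [Finset.mem_filter] at hs ⊢
    exact ⟨X.down_closed s hs.1 t hts, hts.trans hs.2⟩

/-- The faces of the join of two complexes on disjoint vertex sets, given by their faces. -/
def joinFaces (A B : Finset (Finset V)) : Finset (Finset V) :=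
  Finset.image₂ (fun s t => s ∪ t) A B

/-- `Y` is obtained from the `d`-dimensional complex `X` by the bistellar move `α ↦ β` of
index `i = dim β`.  Here `α.powerset`, `α.ssubsets` are the faces of the simplex on `α` and of its
boundary; `dim α + dim β = d`; the induced subcomplex of `X` on `α ∪ β` is the join of the
simplex `α` and the boundary of `β`, and it is replaced by the join of the boundary of `α` and the
simplex `β`. -/
structure IsBistellarMove (d i : ℕ) (α β : Finset V) (X Y : FinComplex V) : Prop where
  nonempty_left : α.Nonempty
  card_right : β.card = i + 1
  card_add_card : α.card + β.card = d + 2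
  disjoint : Disjoint α β
  induced_eq : (X.induced (α ∪ β)).faces = joinFaces α.powerset β.ssubsets
  faces_eq : Y.faces = (X.faces \ joinFaces α.powerset β.ssubsets) ∪
    joinFaces α.ssubsets β.powerset

/-- The complexes with vertices in `V` that are obtained, inside `V`, from the boundary complex of
a simplex with `d + 2` vertices by finitely many bistellar moves of index `< k`. -/
inductive StellatedIn (k d : ℕ) : FinComplex V → Prop
  | sphere (X : FinComplex V) (τ : Finset V) (hτ : τ.card = d + 2) (hX : X.faces = τ.ssubsets) :
      StellatedIn k d X
  | move (X Y : FinComplex V) (i : ℕ) (α β : Finset V) (hX : StellatedIn k d X)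
      (hXY : IsBistellarMove d i α β X Y) (hi : i < k) : StellatedIn k d Y

/-- Isomorphism of complexes: a map that is injective on the vertices of `X` and carries the faces
of `X` onto the faces of `Y`. -/
def Isomorphic (X : FinComplex V) (Y : FinComplex W) : Prop :=
  ∃ f : V → W, Set.InjOn f (X.vertices : Set V) ∧
    Y.faces = X.faces.image (fun s => s.image f)

/-- `X` is a `k`-stellated complex of dimension `d`.  Isomorphic complexes are identified; the
moves are carried out with vertices in `ℕ`, so that there are always enough new vertices for the
moves of index `0`. -/
def IsStellated (k d : ℕ) (X : FinComplex V) : Prop :=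
  ∃ Y : FinComplex ℕ, StellatedIn k d Y ∧ X.Isomorphic Y

end Combinatorics

section FaceVector

variable {V : Type*}

/-- The number of faces with exactly `a` vertices, that is, `f_{a-1}`. -/
def numFaces (X : FinComplex V) (a : ℕ) : ℕ := (X.faces.filter (fun s => s.card = a)).card

/-- The `g`-number
`g_j = ∑_{i=-1}^{j-1} (-1)^{j-i-1} binom(d-i+1, j-i-1) f_i`, `0 ≤ j ≤ d + 1`,
of a complex of dimension `d`, summed over `a = i + 1`. -/
def gNumber (X : FinComplex V) (d j : ℕ) : ℤ :=
  ∑ a ∈ Finset.range (j + 1),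
    (-1 : ℤ) ^ (j - a) * ((d + 2 - a).choose (j - a) : ℤ) * (X.numFaces a : ℤ)

end FaceVector

section Homology

variable (F : Type*) [Field F] {V : Type*} [LinearOrder V]

/-- The simplicial boundary map, with faces oriented by the order of their vertices:
`∂ [v_0 < ⋯ < v_n] = ∑_j (-1)^j [v_0, …, v_{j-1}, v_{j+1}, …, v_n]` for `n ≥ 1`
(the position `j` of `v` in the face is the number of smaller vertices of the face), and the
boundary of a vertex is `0` (unreduced homology). -/
noncomputable def boundary : (Finset V →₀ F) →ₗ[F] (Finset V →₀ F) :=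
  Finsupp.linearCombination F (fun s : Finset V =>
    if s.card ≤ 1 then 0
    else ∑ v ∈ s, Finsupp.single (s.erase v) ((-1 : F) ^ (s.filter (fun w => w < v)).card))

/-- The `n`-chains of `X`: the linear combinations of its `n`-dimensional faces. -/
noncomputable def chains (X : FinComplex V) (n : ℕ) : Submodule F (Finset V →₀ F) :=
  Finsupp.supported F F {s : Finset V | s ∈ X.faces ∧ s.card = n + 1}

/-- The `n`-cycles of `X`. -/
noncomputable def cycles (X : FinComplex V) (n : ℕ) : Submodule F (Finset V →₀ F) :=
  X.chains F n ⊓ LinearMap.ker (boundary F)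

/-- The `n`-boundaries of `X`. -/
noncomputable def boundaries (X : FinComplex V) (n : ℕ) : Submodule F (Finset V →₀ F) :=
  (X.chains F (n + 1)).map (boundary F)

theorem boundary_single (s : Finset V) (c : F) :
    boundary F (Finsupp.single s c) = c • (if s.card ≤ 1 then 0
      else ∑ v ∈ s, Finsupp.single (s.erase v) ((-1 : F) ^ (s.filter (fun w => w < v)).card)) := by
  simp only [boundary, Finsupp.linearCombination_single]

theorem boundary_boundary (c : Finset V →₀ F) : boundary F (boundary F c) = 0 := by
  induction c using Finsupp.induction_linear with
  | zero => simp
  | add f g hf hg => rw [map_add, map_add, hf, hg, add_zero]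
  | single s a =>
    rw [boundary_single, map_smul]
    refine smul_eq_zero_of_right a ?_
    split_ifs with h1
    · simp
    by_cases h2 : s.card ≤ 2
    · rw [map_sum]
      refine Finset.sum_eq_zero fun v hv => ?_
      rw [boundary_single, if_pos (by rw [Finset.card_erase_of_mem hv]; omega), smul_zero]
    have key : ∀ v w : V, v < w → v ∈ s → w ∈ s →
        (-1 : F) ^ (s.filter (fun u => u < v)).card *
            (-1 : F) ^ ((s.erase v).filter (fun u => u < w)).card +
          (-1 : F) ^ (s.filter (fun u => u < w)).card *
            (-1 : F) ^ ((s.erase w).filter (fun u => u < v)).card = 0 := by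
      intro v w hvw hv hw
      have e1 : (s.erase w).filter (fun u => u < v) = s.filter (fun u => u < v) := by
        ext u
        simp only [Finset.mem_filter, Finset.mem_erase]
        exact ⟨fun h => ⟨h.1.2, h.2⟩, fun h => ⟨⟨(h.2.trans hvw).ne, h.1⟩, h.2⟩⟩
      have e2 : (s.filter (fun u => u < w)).card =
          ((s.erase v).filter (fun u => u < w)).card + 1 := by
        have hm : v ∈ s.filter (fun u => u < w) := Finset.mem_filter.2 ⟨hv, hvw⟩
        rw [Finset.filter_erase, Finset.card_erase_of_mem hm]
        have := Finset.card_pos.2 ⟨v, hm⟩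
        omega
      rw [e1, e2]
      ring
    have e : boundary F (∑ v ∈ s, Finsupp.single (s.erase v)
          ((-1 : F) ^ (s.filter (fun w => w < v)).card)) =
        ∑ p ∈ s.offDiag, Finsupp.single ((s.erase p.1).erase p.2)
          ((-1 : F) ^ (s.filter (fun u => u < p.1)).card *
            (-1 : F) ^ ((s.erase p.1).filter (fun u => u < p.2)).card) := by
      have hd : s.offDiag = (s ×ˢ s).filter (fun p => p.2 ≠ p.1) := by
        ext p
        simp only [Finset.mem_offDiag, Finset.mem_filter, Finset.mem_product]
        tauto
      rw [map_sum, hd, Finset.sum_filter, Finset.sum_product]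
      refine Finset.sum_congr rfl fun v hv => ?_
      rw [boundary_single, if_neg (by rw [Finset.card_erase_of_mem hv]; omega),
        ← Finset.sum_filter, Finset.filter_ne', Finset.smul_sum]
      refine Finset.sum_congr rfl fun w _ => ?_
      rw [Finsupp.smul_single, smul_eq_mul]
    rw [e]
    refine Finset.sum_involution (fun p _ => (p.2, p.1)) ?_ ?_ ?_ ?_
    · rintro ⟨v, w⟩ hp
      obtain ⟨hv, hw, hne⟩ := Finset.mem_offDiag.1 hp
      dsimp only at hv hw hne ⊢
      rw [Finset.erase_right_comm (a := w), ← Finsupp.single_add]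
      rcases lt_or_gt_of_ne hne with h | h
      · rw [key v w h hv hw, Finsupp.single_zero]
      · rw [add_comm, key w v h hw hv, Finsupp.single_zero]
    · rintro ⟨v, w⟩ hp _ heq
      exact (Finset.mem_offDiag.1 hp).2.2 (congrArg Prod.snd heq)
    · rintro ⟨v, w⟩ hp
      obtain ⟨hv, hw, hne⟩ := Finset.mem_offDiag.1 hp
      exact Finset.mem_offDiag.2 ⟨hw, hv, hne.symm⟩
    · rintro ⟨v, w⟩ _
      rfl

theorem boundaries_le_cycles (X : FinComplex V) (n : ℕ) :
    X.boundaries F n ≤ X.cycles F n := by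
  rintro _ ⟨c, hc, rfl⟩
  refine ⟨?_, boundary_boundary F c⟩
  have hle : X.chains F (n + 1) ≤ (X.chains F n).comap (boundary F) := by
    rw [chains, Finsupp.supported_eq_span_single, Submodule.span_le]
    rintro _ ⟨s, ⟨hs, hcard⟩, rfl⟩
    change boundary F (Finsupp.single s 1) ∈ X.chains F n
    rw [boundary_single, one_smul, if_neg (by omega)]
    refine Submodule.sum_mem _ fun v hv => Finsupp.single_mem_supported F _ ?_
    exact ⟨X.down_closed s hs _ (Finset.erase_subset v s),
      by rw [Finset.card_erase_of_mem hv]; omega⟩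
  exact hle hc

/-- The Betti number `β_n(X) = dim_F H_n(X; F)`, where the homology `H_n(X; F)` is the quotient of
the space of cycles by the boundaries (which are cycles). -/
noncomputable def betti (X : FinComplex V) (n : ℕ) : ℕ :=
  Module.finrank F (X.cycles F n ⧸ (X.boundaries F n).submoduleOf (X.cycles F n))

/-- The reduced Betti number: `β_0 - 1` in degree `0` (so it is `-1` for the complex whose only
face is the empty one), and `β_n` in degree `n ≥ 1`. -/
noncomputable def reducedBetti (X : FinComplex V) (n : ℕ) : ℤ :=
  (X.betti F n : ℤ) - if n = 0 then 1 else 0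

/-- The entry `σ_i(X) = ∑_{j=0}^m binom(m, j)⁻¹ ∑_{A ⊆ V(X), |A| = j} β̃_i(X[A])` of the
sigma-vector, with `m` the number of vertices of `X`. -/
noncomputable def sigma (X : FinComplex V) (i : ℕ) : ℚ :=
  ∑ j ∈ Finset.range (X.vertices.card + 1),
    (1 / (X.vertices.card.choose j : ℚ)) *
      ∑ A ∈ X.vertices.powersetCard j, ((X.induced A).reducedBetti F i : ℚ)

end Homology

end FinComplex

namespace FinComplex

/-! ### Chain spaces and face numbers. -/

section Chains

variable (F : Type*) [Field F] {V : Type*}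

/-! A bistellar move from X to Y factors through the complex Z obtained from X by filling in the
simplex on α ∪ β: Z is X plus the Boolean interval of faces [β, α ∪ β], and also Y plus [α, α ∪ β].
So it suffices to see what adding one interval does to both sides of (b) and (c).

Sigma side. Up to the factor m + 1, the alternating sum of the σ_i is a weighted average, over
vertex sets A, of alternating sums of reduced Betti numbers of X[A]. Adding [β, α ∪ β] changes X[A]
only if β ⊆ A. If A also meets α, the change is a reversed sequence of collapses, invisible to Betti
numbers (`altBetti_union_Icc`). There remain the A with A ∩ (α ∪ β) = β, where the single face β is
added. The sum up to degree l then changes by (-1)^(l+1-#β) if #β ≤ l + 1, by 0 or -1 if #β = l + 2,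
and not at all otherwise. The weights are beta integrals, so these A have total weight `weight (d +
2) β.card`, whatever the ambient vertex set (`average_indicator`).

g side. The interval adds 1 to g_j for j = #β and changes no other g_j (`gNumber_union_Icc`), so the
g-sum changes by the same amount when #β ≤ l + 1. Hence `deficit`, the difference of the two sides,
is unchanged unless #β = l + 2, when it can only decrease.

For a move of index < k one has #β ≤ k and #α ≥ d + 2 - k. For l ≤ d - k - 1 the step from Z to Y
preserves the deficit, and the step from X to Z can lower it only if l + 2 ≤ k. The deficit is 0 for
the boundary of a simplex, which gives (b) and (c). The same bookkeeping gives g_j = 0 for k < j ≤ d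
- k, and (a) follows by adding consecutive cases of (c). -/

instance finiteDimensional_chains (X : FinComplex V) (n : ℕ) :
    FiniteDimensional F (X.chains F n) := by
  have hfin : {s : Finset V | s ∈ X.faces ∧ s.card = n + 1}.Finite :=
    X.faces.finite_toSet.subset fun s hs => hs.1
  have := hfin.to_subtype
  exact Module.Finite.equiv (Finsupp.supportedEquivFinsupp (M := F) (R := F)
    {s : Finset V | s ∈ X.faces ∧ s.card = n + 1}).symm

theorem finrank_chains (X : FinComplex V) (n : ℕ) :
    Module.finrank F (X.chains F n) = X.numFaces (n + 1) := by
  have e : {s : Finset V | s ∈ X.faces ∧ s.card = n + 1} =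
      ((X.faces.filter (fun s => s.card = n + 1) : Finset (Finset V)) : Set (Finset V)) := by
    ext s; simp
  rw [chains, (Finsupp.supportedEquivFinsupp (M := F) (R := F) _).finrank_eq, e,
    Module.finrank_finsupp_self]
  simp [numFaces]

theorem numFaces_zero (X : FinComplex V) : X.numFaces 0 = 1 := by
  rw [numFaces, Finset.card_eq_one]
  refine ⟨∅, ?_⟩
  ext s
  simp only [Finset.mem_filter, Finset.card_eq_zero, Finset.mem_singleton]
  exact ⟨fun h => h.2, fun h => ⟨h ▸ X.empty_mem, h⟩⟩

end Chains

/-! ### Alternating Betti sums through ranks of boundary maps. -/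

section Homology

variable (F : Type*) [Field F] {V : Type*} [LinearOrder V]

instance finiteDimensional_boundaries (X : FinComplex V) (n : ℕ) :
    FiniteDimensional F (X.boundaries F n) := by
  unfold boundaries; infer_instance

instance finiteDimensional_cycles (X : FinComplex V) (n : ℕ) :
    FiniteDimensional F (X.cycles F n) := by
  unfold cycles; infer_instance

theorem boundary_apply_of_mem_chains_zero (X : FinComplex V) {c : Finset V →₀ F}
    (hc : c ∈ X.chains F 0) : boundary F c = 0 := by
  have hle : X.chains F 0 ≤ LinearMap.ker (boundary F) := by
    rw [chains, Finsupp.supported_eq_span_single, Submodule.span_le]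
    rintro _ ⟨s, ⟨hs, hcard⟩, rfl⟩
    change boundary F (Finsupp.single s 1) = 0
    rw [boundary_single, if_pos (by omega), smul_zero]
  exact hle hc

theorem finrank_cycles_zero (X : FinComplex V) :
    Module.finrank F (X.cycles F 0) = X.numFaces 1 := by
  rw [← finrank_chains F X 0]
  have : X.cycles F 0 = X.chains F 0 :=
    inf_eq_left.2 fun c hc => boundary_apply_of_mem_chains_zero F X hc
  rw [this]

theorem finrank_cycles_succ (X : FinComplex V) (n : ℕ) :
    Module.finrank F (X.cycles F (n + 1)) + Module.finrank F (X.boundaries F n) =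
      X.numFaces (n + 2) := by
  rw [← finrank_chains F X (n + 1)]
  have h := LinearMap.finrank_range_add_finrank_ker
    ((boundary F).domRestrict (X.chains F (n + 1)))
  rw [← h, add_comm]
  congr 1
  · rw [boundaries, LinearMap.range_domRestrict]
  · rw [LinearMap.ker_domRestrict, cycles, ← Submodule.map_comap_subtype]
    exact (LinearEquiv.finrank_eq (Submodule.equivMapOfInjective _
      (Submodule.injective_subtype _) _)).symm

theorem betti_add_finrank_boundaries (X : FinComplex V) (n : ℕ) :
    X.betti F n + Module.finrank F (X.boundaries F n) = Module.finrank F (X.cycles F n) := by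
  rw [betti, ← Submodule.finrank_quotient_add_finrank
    ((X.boundaries F n).submoduleOf (X.cycles F n))]
  congr 1
  exact (LinearEquiv.finrank_eq
    (Submodule.submoduleOfEquivOfLe (boundaries_le_cycles F X n))).symm

/-- The alternating sum `∑_{i ≤ l} (-1)^{l-i} β̃_i(X)`, in terms of face numbers and the rank of
the boundary map in degree `l + 1`. -/
noncomputable def altBetti (X : FinComplex V) (l : ℕ) : ℤ :=
  ∑ a ∈ Finset.range (l + 2), (-1 : ℤ) ^ (l + 1 - a) * (X.numFaces a : ℤ) -
    (Module.finrank F (X.boundaries F l) : ℤ)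

theorem sum_neg_one_pow_succ {R : Type*} [CommRing R] (f : ℕ → R) (n : ℕ) :
    ∑ a ∈ Finset.range (n + 2), (-1 : R) ^ (n + 1 - a) * f a =
      f (n + 1) - ∑ a ∈ Finset.range (n + 1), (-1 : R) ^ (n - a) * f a := by
  rw [Finset.sum_range_succ, Nat.sub_self, pow_zero, one_mul, add_comm, sub_eq_add_neg,
    ← Finset.sum_neg_distrib]
  congr 1
  refine Finset.sum_congr rfl fun a ha => ?_
  rw [Finset.mem_range] at ha
  rw [show n + 1 - a = n - a + 1 by omega, pow_succ]
  ring

/-- Rank-nullity makes the intermediate boundary ranks telescope. The correction -1 in degree 0 is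
the contribution of the empty face, the term a = 0, so no special case is needed for the complex
with no vertices. -/
theorem sum_reducedBetti_eq_altBetti (X : FinComplex V) (l : ℕ) :
    ∑ i ∈ Finset.range (l + 1), (-1 : ℤ) ^ (l - i) * X.reducedBetti F i = X.altBetti F l := by
  induction l with
  | zero =>
    have h1 := betti_add_finrank_boundaries F X 0
    rw [finrank_cycles_zero] at h1
    simp only [altBetti, reducedBetti, Finset.sum_range_succ, Finset.sum_range_zero,
      numFaces_zero, ← h1]
    push_cast
    simp
    ring
  | succ l ih =>
    have h1 := betti_add_finrank_boundaries F X (l + 1)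
    have h2 := finrank_cycles_succ F X l
    rw [sum_neg_one_pow_succ, ih, altBetti, altBetti, sum_neg_one_pow_succ _ (l + 1), reducedBetti,
      if_neg (by omega), ← h2, ← h1]
    push_cast
    ring

theorem altBetti_congr {X Y : FinComplex V} (h : X.faces = Y.faces) (l : ℕ) :
    X.altBetti F l = Y.altBetti F l := by
  rw [FinComplex.ext h]

end Homology

/-! ### Effect of adding faces: single faces, collapses, Boolean intervals. -/

section AddFace

variable (F : Type*) [Field F] {V : Type*} [LinearOrder V]

theorem numFaces_insert {X Z : FinComplex V} {s : Finset V} (hs : s ∉ X.faces)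
    (hZ : Z.faces = insert s X.faces) (a : ℕ) :
    Z.numFaces a = X.numFaces a + if s.card = a then 1 else 0 := by
  rw [numFaces, hZ, Finset.filter_insert]
  split_ifs with h
  · rw [Finset.card_insert_of_notMem (fun h' => hs (Finset.mem_filter.1 h').1), numFaces]
  · rfl

theorem sum_numFaces_insert {X Z : FinComplex V} {s : Finset V} (hs : s ∉ X.faces)
    (hZ : Z.faces = insert s X.faces) (l : ℕ) :
    ∑ a ∈ Finset.range (l + 2), (-1 : ℤ) ^ (l + 1 - a) * (Z.numFaces a : ℤ) =
      ∑ a ∈ Finset.range (l + 2), (-1 : ℤ) ^ (l + 1 - a) * (X.numFaces a : ℤ) +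
        if s.card < l + 2 then (-1) ^ (l + 1 - s.card) else 0 := by
  simp only [numFaces_insert hs hZ, Nat.cast_add, mul_add, Finset.sum_add_distrib]
  congr 1
  simp [Nat.cast_ite]

theorem chains_insert_of_ne {X Z : FinComplex V} {s : Finset V}
    (hZ : Z.faces = insert s X.faces) {n : ℕ} (hn : s.card ≠ n + 1) :
    Z.chains F n = X.chains F n := by
  rw [chains, chains]
  congr 1
  ext t
  simp only [hZ, Finset.mem_insert, Set.mem_ofPred_eq]
  constructor
  · rintro ⟨rfl | h, h'⟩
    · exact absurd h' hn
    · exact ⟨h, h'⟩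
  · exact fun h => ⟨Or.inr h.1, h.2⟩

theorem chains_insert_of_eq {X Z : FinComplex V} {s : Finset V}
    (hZ : Z.faces = insert s X.faces) {n : ℕ} (hn : s.card = n + 1) :
    Z.chains F n = X.chains F n ⊔ Submodule.span F {Finsupp.single s 1} := by
  rw [chains, chains, ← Set.image_singleton (f := fun t : Finset V => Finsupp.single t (1 : F)),
    ← Finsupp.supported_eq_span_single, ← Finsupp.supported_union]
  congr 1
  ext t
  simp only [hZ, Finset.mem_insert, Set.mem_ofPred_eq, Set.mem_union, Set.mem_singleton_iff]
  constructor
  · rintro ⟨rfl | h, h'⟩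
    · exact Or.inr rfl
    · exact Or.inl ⟨h, h'⟩
  · rintro (h | rfl)
    · exact ⟨Or.inr h.1, h.2⟩
    · exact ⟨Or.inl rfl, hn⟩

theorem boundaries_insert_of_eq {X Z : FinComplex V} {s : Finset V}
    (hZ : Z.faces = insert s X.faces) {l : ℕ} (hl : s.card = l + 2) :
    Z.boundaries F l =
      X.boundaries F l ⊔ Submodule.span F {boundary F (Finsupp.single s 1)} := by
  rw [boundaries, chains_insert_of_eq F hZ hl, Submodule.map_sup, Submodule.map_span,
    Set.image_singleton, boundaries]

theorem altBetti_insert_of_lt {X Z : FinComplex V} {s : Finset V} (hs : s ∉ X.faces)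
    (hZ : Z.faces = insert s X.faces) {l : ℕ} (hl : l + 2 < s.card) :
    Z.altBetti F l = X.altBetti F l := by
  rw [altBetti, sum_numFaces_insert hs hZ, if_neg (by omega), boundaries,
    chains_insert_of_ne F hZ (by omega), altBetti, boundaries, add_zero]

/-- The rank term involves only faces with l + 2 vertices, so a smaller face is seen only by the
face count. -/
theorem altBetti_insert_of_le {X Z : FinComplex V} {s : Finset V} (hs : s ∉ X.faces)
    (hZ : Z.faces = insert s X.faces) {l : ℕ} (hl : s.card ≤ l + 1) :
    Z.altBetti F l = X.altBetti F l + (-1) ^ (l + 1 - s.card) := by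
  rw [altBetti, sum_numFaces_insert hs hZ, if_pos (by omega), boundaries,
    chains_insert_of_ne F hZ (by omega), altBetti, boundaries]
  ring

/-- The relevant face counts stay the same while the space of boundaries can only grow. This is the
sole source of the inequality in (b). -/
theorem altBetti_insert_le {X Z : FinComplex V} {s : Finset V} (hs : s ∉ X.faces)
    (hZ : Z.faces = insert s X.faces) {l : ℕ} (hl : s.card = l + 2) :
    Z.altBetti F l ≤ X.altBetti F l := by
  have h : Module.finrank F (X.boundaries F l) ≤ Module.finrank F (Z.boundaries F l) :=
    Submodule.finrank_mono (by rw [boundaries_insert_of_eq F hZ hl]; exact le_sup_left)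
  rw [altBetti, sum_numFaces_insert hs hZ, if_neg (by omega), altBetti]
  omega

theorem altBetti_insert_of_mem {X Z : FinComplex V} {s : Finset V} (hs : s ∉ X.faces)
    (hZ : Z.faces = insert s X.faces) {l : ℕ} (hl : s.card = l + 2)
    (hb : boundary F (Finsupp.single s 1) ∈ X.boundaries F l) :
    Z.altBetti F l = X.altBetti F l := by
  rw [altBetti, sum_numFaces_insert hs hZ, if_neg (by omega), boundaries_insert_of_eq F hZ hl,
    sup_eq_left.2 ((Submodule.span_singleton_le_iff_mem _ _).2 hb), altBetti, add_zero]

theorem altBetti_insert_of_notMem {X Z : FinComplex V} {s : Finset V} (hs : s ∉ X.faces)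
    (hZ : Z.faces = insert s X.faces) {l : ℕ} (hl : s.card = l + 2)
    (hb : boundary F (Finsupp.single s 1) ∉ X.boundaries F l) :
    Z.altBetti F l = X.altBetti F l - 1 := by
  have h0 : boundary F (Finsupp.single s 1) ≠ 0 := fun h => hb (h ▸ Submodule.zero_mem _)
  have h := Submodule.finrank_sup_add_finrank_inf_eq (X.boundaries F l)
    (Submodule.span F {boundary F (Finsupp.single s 1)})
  rw [finrank_span_singleton h0,
    ((Submodule.disjoint_span_singleton' h0).2 hb).eq_bot, finrank_bot, add_zero] at h
  rw [altBetti, sum_numFaces_insert hs hZ, if_neg (by omega), boundaries_insert_of_eq F hZ hl, h,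
    altBetti]
  push_cast
  ring

theorem boundary_single_of_one_lt {s : Finset V} (hs : 1 < s.card) :
    boundary F (Finsupp.single s 1) =
      ∑ v ∈ s, Finsupp.single (s.erase v) ((-1 : F) ^ (s.filter (fun w => w < v)).card) := by
  rw [boundary_single, one_smul, if_neg (by omega)]

/-- If all codimension one faces of `insert v s` other than `s` are in `X`, the boundary of `s`
is a boundary in `X`. -/
theorem boundary_mem_of_free_face (X : FinComplex V) {s : Finset V} {v : V} (hv : v ∉ s)
    {l : ℕ} (hl : s.card = l + 2) (hX : ∀ u ∈ s, (insert v s).erase u ∈ X.faces) :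
    boundary F (Finsupp.single s 1) ∈ X.boundaries F l := by
  have hc := Finset.card_insert_of_notMem hv
  -- ∂∂ = 0 on the cone v * s: up to sign, ∂s is the boundary of the remaining facets, all of which
  -- lie in X.
  have h := boundary_boundary F (Finsupp.single (insert v s) 1)
  rw [boundary_single_of_one_lt F (by omega), Finset.sum_insert hv, Finset.erase_insert hv,
    map_add] at h
  set ε : F := (-1 : F) ^ ((insert v s).filter (fun w => w < v)).card with hε
  have hε0 : ε ≠ 0 := pow_ne_zero _ (by simp)
  have e : Finsupp.single s ε = ε • Finsupp.single s (1 : F) := by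
    rw [Finsupp.smul_single, smul_eq_mul, mul_one]
  rw [e, map_smul] at h
  have hmem : ε • boundary F (Finsupp.single s 1) ∈ X.boundaries F l := by
    rw [eq_neg_of_add_eq_zero_left h]
    refine Submodule.neg_mem _ (Submodule.mem_map_of_mem (Submodule.sum_mem _ fun u hu => ?_))
    refine Finsupp.single_mem_supported F _ ⟨hX u hu, ?_⟩
    rw [Finset.card_erase_of_mem (Finset.mem_insert_of_mem hu)]
    omega
  exact (Submodule.smul_mem_iff _ hε0).1 hmem

/-- Only faces containing s contribute to the coefficient of s. That coefficient is ±1 in the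
boundary of `insert v s`, which is the obstruction used below. -/
theorem boundary_apply_eq_zero (X : FinComplex V) {s : Finset V} {n : ℕ}
    (hX : ∀ t ∈ X.faces, t.card = n + 1 → ¬ s ⊆ t) {c : Finset V →₀ F}
    (hc : c ∈ X.chains F n) : boundary F c s = 0 := by
  have hle : X.chains F n ≤ LinearMap.ker ((Finsupp.lapply s).comp (boundary F)) := by
    rw [chains, Finsupp.supported_eq_span_single, Submodule.span_le]
    rintro _ ⟨t, ⟨ht, hcard⟩, rfl⟩
    change boundary F (Finsupp.single t 1) s = 0
    rw [boundary_single, one_smul]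
    split_ifs with h
    · rfl
    · rw [Finsupp.finsetSum_apply]
      refine Finset.sum_eq_zero fun v hv => Finsupp.single_eq_of_ne ?_
      rintro rfl
      exact hX t ht hcard (Finset.erase_subset _ _)
  exact hle hc

/-- A face with a codimension one face not contained in any other face of the same dimension does
not have the boundary of a chain of the other faces. -/
theorem boundary_notMem_of_free_face (X : FinComplex V) {s : Finset V} {v : V} (hv : v ∉ s)
    {l : ℕ} (hl : s.card = l + 1) (hX : ∀ t ∈ X.faces, t.card = l + 2 → ¬ s ⊆ t) :
    boundary F (Finsupp.single (insert v s) 1) ∉ X.boundaries F l := by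
  rintro ⟨c, hc, h⟩
  have h0 := boundary_apply_eq_zero F X hX hc
  have hcard := Finset.card_insert_of_notMem hv
  rw [h, boundary_single_of_one_lt F (by omega), Finset.sum_insert hv, Finset.erase_insert hv,
    Finsupp.add_apply, Finsupp.single_eq_same, Finsupp.finsetSum_apply,
    Finset.sum_eq_zero, add_zero] at h0
  · exact pow_ne_zero _ (by simp) h0
  · intro u hu
    refine Finsupp.single_eq_of_ne fun h' => ?_
    have : v ∈ s := by
      rw [h', Finset.mem_erase]
      exact ⟨fun h => hv (h ▸ hu), Finset.mem_insert_self _ _⟩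
    exact hv this

/-- An elementary collapse does not change the alternating sums of the Betti numbers. -/
theorem altBetti_elementary_collapse {X Z : FinComplex V} {s : Finset V} {v : V} (hv : v ∉ s)
    (hs0 : s.Nonempty) (hs : s ∉ X.faces)
    (hZ : Z.faces = insert (insert v s) (insert s X.faces)) (l : ℕ) :
    Z.altBetti F l = X.altBetti F l := by
  have hsv : insert v s ∉ X.faces := fun h =>
    hs (X.down_closed _ h _ (Finset.subset_insert _ _))
  have hne : insert v s ≠ s := fun h => hv (h ▸ Finset.mem_insert_self v s)
  have hfree : ∀ t ∈ X.faces, ¬ s ⊆ t := fun t ht h => hs (X.down_closed t ht s h)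
  have hmem : ∀ t ⊆ insert v s, t ≠ insert v s → t ≠ s → t ∈ X.faces := by
    intro t ht h1 h2
    have : t ∈ Z.faces := Z.down_closed (insert v s) (by simp [hZ]) t ht
    simpa [hZ, h1, h2] using this
  have hcard := Finset.card_insert_of_notMem hv
  let W : FinComplex V :=
    { faces := insert s X.faces
      empty_mem := Finset.mem_insert_of_mem X.empty_mem
      down_closed := by
        intro a ha t hta
        rcases Finset.mem_insert.1 ha with rfl | ha
        · by_cases h : t = a
          · simp [h]
          · refine Finset.mem_insert_of_mem (hmem t (hta.trans (Finset.subset_insert _ _)) ?_ h)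
            rintro rfl
            exact hv (hta (Finset.mem_insert_self _ _))
        · exact Finset.mem_insert_of_mem (X.down_closed a ha t hta) }
  have hW : W.faces = insert s X.faces := rfl
  have hZW : Z.faces = insert (insert v s) W.faces := hZ
  have hsW : insert v s ∉ W.faces := by simp [hW, hne, hsv]
  have hpos := hs0.card_pos
  -- The pair is added as s, then `insert v s`. If #s = l + 2, ∂s already bounds in X; if #s = l +
  -- 1, the changes are +1 and -1; for smaller s they are opposite signs from the face counts.
  rcases lt_trichotomy (l + 2) s.card with h | h | h
  · rw [altBetti_insert_of_lt F hsW hZW (by omega), altBetti_insert_of_lt F hs hW h]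
  · rw [altBetti_insert_of_lt F hsW hZW (by omega), altBetti_insert_of_mem F hs hW h.symm]
    refine boundary_mem_of_free_face F X hv h.symm fun u hu => ?_
    refine hmem _ (Finset.erase_subset _ _) ?_ ?_
    · exact (Finset.erase_ssubset (Finset.mem_insert_of_mem hu)).ne
    · intro h
      exact hv (h ▸ Finset.mem_erase.2 ⟨fun h => hv (h ▸ hu), Finset.mem_insert_self _ _⟩)
  · rcases eq_or_lt_of_le (Nat.le_of_lt_succ h) with h | h
    · rw [altBetti_insert_of_notMem F hsW hZW (by omega), altBetti_insert_of_le F hs hW h.le, h]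
      · simp
      · refine boundary_notMem_of_free_face F W hv h fun t ht htc hst => ?_
        rcases Finset.mem_insert.1 ht with rfl | ht
        · omega
        · exact hfree t ht hst
    · rw [altBetti_insert_of_le F hsW hZW (by omega), altBetti_insert_of_le F hs hW h.le, hcard,
        show l + 1 - s.card = l + 1 - (s.card + 1) + 1 by omega, pow_succ]
      ring

/-- Adding a non-trivial Boolean interval of faces does not change the alternating sums of the
Betti numbers. -/
theorem altBetti_union_Icc (α : Finset V) : ∀ {X Z : FinComplex V} {β : Finset V},
    α.Nonempty → Disjoint α β → β.Nonempty → β ∉ X.faces →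
    Z.faces = X.faces ∪ Finset.Icc β (α ∪ β) → ∀ l : ℕ, Z.altBetti F l = X.altBetti F l := by
  induction α using Finset.induction_on with
  | empty => intro _ _ _ h; simp at h
  | insert u α hu ih =>
    intro X Z β _ hdisj hβ hX hZ l
    have huβ : u ∉ β := Finset.disjoint_left.1 hdisj (Finset.mem_insert_self _ _)
    have hαβ : Disjoint α β := hdisj.mono_left (Finset.subset_insert _ _)
    have hfree : ∀ t ∈ X.faces, ¬ β ⊆ t := fun t ht h => hX (X.down_closed t ht β h)
    rcases α.eq_empty_or_nonempty with rfl | hα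
    · refine altBetti_elementary_collapse F huβ hβ hX ?_ l
      rw [hZ]
      ext t
      simp only [Finset.mem_union, Finset.mem_Icc, Finset.mem_insert,
        insert_empty_eq, ← Finset.insert_eq]
      constructor
      · rintro (h | ⟨h1, h2⟩)
        · exact Or.inr (Or.inr h)
        · by_cases hut : u ∈ t
          · exact Or.inl (h2.antisymm (Finset.insert_subset hut h1))
          · exact Or.inr (Or.inl (((Finset.subset_insert_iff_of_notMem hut).1 h2).antisymm h1))
      · rintro (rfl | rfl | h)
        · exact Or.inr ⟨Finset.subset_insert _ _, subset_rfl⟩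
        · exact Or.inr ⟨subset_rfl, Finset.subset_insert _ _⟩
        · exact Or.inl h
    -- The interval is split by membership of u: W contains the half without u, which is [β, α ∪ β],
    -- and the other half is [β ∪ {u}, α ∪ β ∪ {u}]. Both have the shape needed for induction.
    · let W : FinComplex V :=
        { faces := Z.faces.filter (fun t => ¬ insert u β ⊆ t)
          empty_mem := by simp [Z.empty_mem]
          down_closed := by
            intro s hs t hts
            rw [Finset.mem_filter] at hs ⊢
            exact ⟨Z.down_closed s hs.1 t hts, fun h => hs.2 (h.trans hts)⟩ }
      have hW : W.faces = X.faces ∪ Finset.Icc β (α ∪ β) := by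
        ext t
        change t ∈ Z.faces.filter (fun t => ¬ insert u β ⊆ t) ↔ _
        simp only [hZ, Finset.mem_filter, Finset.mem_union, Finset.mem_Icc,
          Finset.insert_union, Finset.insert_subset_iff, not_and]
        constructor
        · rintro ⟨h | ⟨h1, h2⟩, h3⟩
          · exact Or.inl h
          · have hut : u ∉ t := fun h => h3 h h1
            exact Or.inr ⟨h1, (Finset.subset_insert_iff_of_notMem hut).1 h2⟩
        · rintro (h | ⟨h1, h2⟩)
          · exact ⟨Or.inl h, fun _ => hfree t h⟩
          · refine ⟨Or.inr ⟨h1, h2.trans (Finset.subset_insert _ _)⟩, fun h => ?_⟩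
            rcases Finset.mem_union.1 (h2 h) with h | h
            · exact absurd h hu
            · exact absurd h huβ
      have hZW : Z.faces = W.faces ∪ Finset.Icc (insert u β) (α ∪ insert u β) := by
        ext t
        simp only [hW, hZ, Finset.mem_union, Finset.mem_Icc,
          Finset.insert_union, Finset.union_insert, Finset.insert_subset_iff]
        constructor
        · rintro (h | ⟨h1, h2⟩)
          · exact Or.inl (Or.inl h)
          · by_cases hut : u ∈ t
            · exact Or.inr ⟨⟨hut, h1⟩, h2⟩
            · exact Or.inl (Or.inr ⟨h1, (Finset.subset_insert_iff_of_notMem hut).1 h2⟩)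
        · rintro ((h | ⟨h1, h2⟩) | ⟨⟨_, h1⟩, h2⟩)
          · exact Or.inl h
          · exact Or.inr ⟨h1, h2.trans (Finset.subset_insert _ _)⟩
          · exact Or.inr ⟨h1, h2⟩
      have hβW : insert u β ∉ W.faces := by simp [W]
      rw [ih hα (Finset.disjoint_insert_right.2 ⟨hu, hαβ⟩) (Finset.insert_nonempty _ _)
        hβW hZW l, ih hα hαβ hβ hX hW l]

end AddFace

/-! ### Beta-integral weights and averages over subsets. -/

section Average

/-- The weight `1 / ((n + 1) binom(n, a))`, which is the value of the beta integral
`∫_0^1 x^a (1 - x)^{n - a} dx`. -/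
def weight (n a : ℕ) : ℚ := 1 / (((n : ℚ) + 1) * (n.choose a : ℚ))

theorem weight_nonneg (n a : ℕ) : 0 ≤ weight n a := by
  unfold weight; positivity

/-- In terms of beta integrals, this is multiplication of the integrand by 1 = (1 - x) + x. -/
theorem weight_eq_add {n a : ℕ} (h : a ≤ n) :
    weight n a = weight (n + 1) a + weight (n + 1) (a + 1) := by
  have h1 : (0 : ℚ) < n.choose a := by exact_mod_cast Nat.choose_pos h
  have h2 : (0 : ℚ) < (n + 1).choose a := by exact_mod_cast Nat.choose_pos (by omega)
  have h3 : (0 : ℚ) < (n + 1).choose (a + 1) := by exact_mod_cast Nat.choose_pos (by omega)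
  have e1 : ((n + 1 : ℚ)) * n.choose a = (n + 1).choose (a + 1) * (a + 1) := by
    exact_mod_cast Nat.add_one_mul_choose_eq n a
  have e2 : ((n + 1).choose (a + 1) : ℚ) * (a + 1) = (n + 1).choose a * (n + 1 - a) := by
    have := Nat.choose_succ_right_eq (n + 1) a
    have hc : ((n + 1 - a : ℕ) : ℚ) = n + 1 - a := by push_cast [Nat.cast_sub (by omega : a ≤ n + 1)]; ring
    rw [← hc]
    exact_mod_cast this
  have ha : (0 : ℚ) ≤ a := Nat.cast_nonneg a
  have hna : (a : ℚ) ≤ n := Nat.cast_le.2 h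
  have f2 : ((n + 1).choose a : ℚ) = (n + 1) * n.choose a / (n + 1 - a) := by
    rw [e1, e2, mul_div_assoc, div_self (by linarith), mul_one]
  have f3 : ((n + 1).choose (a + 1) : ℚ) = (n + 1) * n.choose a / (a + 1) := by
    rw [e1, mul_div_assoc, div_self (by linarith), mul_one]
  unfold weight
  rw [f2, f3]
  push_cast
  have : (n : ℚ) + 1 - a ≠ 0 := by linarith
  field_simp
  ring

variable {V : Type*}

/-- The weighted average of a function over the subsets of `U`. -/
def average (U : Finset V) (φ : Finset V → ℚ) : ℚ :=
  ∑ A ∈ U.powerset, weight U.card A.card * φ A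

theorem average_congr {U : Finset V} {φ ψ : Finset V → ℚ} (h : ∀ A ⊆ U, φ A = ψ A) :
    average U φ = average U ψ :=
  Finset.sum_congr rfl fun A hA => by rw [h A (Finset.mem_powerset.1 hA)]

theorem average_mono {U : Finset V} {φ ψ : Finset V → ℚ} (h : ∀ A ⊆ U, φ A ≤ ψ A) :
    average U φ ≤ average U ψ :=
  Finset.sum_le_sum fun A hA =>
    mul_le_mul_of_nonneg_left (h A (Finset.mem_powerset.1 hA)) (weight_nonneg _ _)

theorem average_add (U : Finset V) (φ ψ : Finset V → ℚ) :
    average U (fun A => φ A + ψ A) = average U φ + average U ψ := by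
  simp only [average, mul_add, Finset.sum_add_distrib]

theorem average_const_mul (U : Finset V) (c : ℚ) (φ : Finset V → ℚ) :
    average U (fun A => c * φ A) = c * average U φ := by
  simp only [average, Finset.mul_sum]
  exact Finset.sum_congr rfl fun A _ => by ring

theorem average_sum {ι : Type*} (s : Finset ι) (U : Finset V) (φ : ι → Finset V → ℚ) :
    average U (fun A => ∑ i ∈ s, φ i A) = ∑ i ∈ s, average U (φ i) := by
  simp only [average, Finset.mul_sum]
  exact Finset.sum_comm

variable [DecidableEq V]

/-- The average is an expectation over a random subset: pick p uniformly in [0, 1] and include each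
element independently with probability p. Elements that do not influence φ can be dropped, which
allows comparison of complexes with different vertex sets. -/
theorem average_insert {U : Finset V} {x : V} (hx : x ∉ U) {φ : Finset V → ℚ}
    (h : ∀ A ⊆ U, φ (insert x A) = φ A) : average (insert x U) φ = average U φ := by
  rw [average, Finset.sum_powerset_insert hx, ← Finset.sum_add_distrib, average]
  refine Finset.sum_congr rfl fun A hA => ?_
  have hA := Finset.mem_powerset.1 hA
  rw [h A hA, Finset.card_insert_of_notMem hx,
    Finset.card_insert_of_notMem (fun h => hx (hA h)), weight_eq_add (Finset.card_le_card hA)]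
  ring

/-- The average of a function that depends on the elements in `U` only can be computed in any
larger set. -/
theorem average_of_subset {U U' : Finset V} (hU : U ⊆ U') {φ : Finset V → ℚ}
    (h : ∀ A, φ (A ∩ U) = φ A) : average U' φ = average U φ := by
  obtain ⟨T, hT, rfl⟩ : ∃ T, Disjoint U T ∧ U ∪ T = U' :=
    ⟨U' \ U, Finset.disjoint_sdiff, Finset.union_sdiff_of_subset hU⟩
  clear hU
  induction T using Finset.induction_on with
  | empty => rw [Finset.union_empty]
  | insert x T hx ih =>
    have hxU : x ∉ U := fun h => Finset.disjoint_left.1 hT h (Finset.mem_insert_self _ _)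
    rw [Finset.union_insert, average_insert, ih (hT.mono_right (Finset.subset_insert _ _))]
    · simp [hx, hxU]
    · intro A _
      rw [← h, Finset.insert_inter_of_notMem hxU, h]

theorem average_indicator {U T B : Finset V} (hT : T ⊆ U) (hB : B ⊆ T) :
    average U (fun A => if A ∩ T = B then 1 else 0) = weight T.card B.card := by
  rw [average_of_subset hT (fun A => by simp), average, Finset.sum_eq_single B]
  · rw [Finset.inter_eq_left.2 hB, if_pos rfl, mul_one]
  · intro A hA hne
    rw [Finset.inter_eq_left.2 (Finset.mem_powerset.1 hA), if_neg hne, mul_zero]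
  · exact fun h => absurd (Finset.mem_powerset.2 hB) h

end Average

/-! ### The g-numbers of a Boolean interval. -/

section GNumber

/-- With n = #α and b = #β, `n.choose (a - b)` counts the faces of size a in [β, α ∪ β], so the
interval has a unit vector as its g-vector when n + b = d + 2. Trinomial revision turns the sum into
an alternating sum of a row of Pascal's triangle. -/
theorem sum_gNumber_coeff (n b j : ℕ) :
    ∑ a ∈ Finset.range (j + 1), (-1 : ℤ) ^ (j - a) * ((n + b - a).choose (j - a) : ℤ) *
      (if b ≤ a then (n.choose (a - b) : ℤ) else 0) = if j = b then 1 else 0 := by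
  rcases lt_or_ge j b with h | h
  · rw [if_neg (by omega)]
    refine Finset.sum_eq_zero fun a ha => ?_
    rw [Finset.mem_range] at ha
    rw [if_neg (by omega), mul_zero]
  · obtain ⟨J, rfl⟩ := Nat.exists_eq_add_of_le h
    rw [show b + J + 1 = b + (J + 1) by ring, Finset.sum_range_add, Finset.sum_eq_zero, zero_add]
    · have key : ∀ c ∈ Finset.range (J + 1),
          (-1 : ℤ) ^ (b + J - (b + c)) * ((n + b - (b + c)).choose (b + J - (b + c)) : ℤ) *
            (if b ≤ b + c then (n.choose (b + c - b) : ℤ) else 0) =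
          (-1) ^ J * (n.choose J) * ((-1) ^ c * (J.choose c : ℤ)) := by
        intro c hc
        have hc : c ≤ J := by rw [Finset.mem_range] at hc; omega
        rw [if_pos (by omega), show b + J - (b + c) = J - c by omega,
          show n + b - (b + c) = n - c by omega, show b + c - b = c by omega]
        have h1 : (-1 : ℤ) ^ (J - c) = (-1) ^ J * (-1) ^ c := by
          obtain ⟨e, rfl⟩ := Nat.exists_eq_add_of_le hc
          rw [Nat.add_sub_cancel_left, pow_add, mul_right_comm, ← pow_add, ← two_mul, pow_mul]
          simp
        rw [h1]
        have h2 : (n.choose J : ℤ) * J.choose c = n.choose c * (n - c).choose (J - c) := by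
          exact_mod_cast Nat.choose_mul hc
        linear_combination (-(-1) ^ J * (-1) ^ c) * h2
      rw [Finset.sum_congr rfl key, ← Finset.mul_sum, Int.alternating_sum_range_choose]
      by_cases hJ : J = 0
      · simp [hJ]
      · simp [hJ]
    · intro a ha
      rw [Finset.mem_range] at ha
      rw [if_neg (by omega), mul_zero]

variable {V : Type*}

theorem gNumber_powerset {X : FinComplex V} {τ : Finset V} {d : ℕ} (hτ : τ.card = d + 2)
    (hX : X.faces = τ.powerset) (j : ℕ) : X.gNumber d j = if j = 0 then 1 else 0 := by
  rw [← sum_gNumber_coeff τ.card 0 j, gNumber]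
  refine Finset.sum_congr rfl fun a _ => ?_
  have : X.numFaces a = τ.card.choose a := by
    rw [numFaces, hX, ← Finset.powersetCard_eq_filter, Finset.card_powersetCard]
  rw [this, add_zero, hτ, if_pos (Nat.zero_le _), Nat.sub_zero]

variable [DecidableEq V]

theorem card_filter_Icc {α β : Finset V} (h : Disjoint α β) (a : ℕ) :
    ((Finset.Icc β (α ∪ β)).filter (fun s => s.card = a)).card =
      if β.card ≤ a then α.card.choose (a - β.card) else 0 := by
  split_ifs with ha
  · rw [← Finset.card_powersetCard]
    refine Finset.card_nbij' (fun s => s \ β) (fun t => t ∪ β) ?_ ?_ ?_ ?_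
    · intro s hs
      simp only [Finset.coe_filter, Finset.mem_Icc, Set.mem_ofPred_eq, Finset.mem_coe,
        Finset.mem_powersetCard] at hs ⊢
      refine ⟨?_, by rw [Finset.card_sdiff_of_subset hs.1.1, hs.2]⟩
      exact sdiff_le_iff.2 (by rw [sup_comm]; exact hs.1.2)
    · intro t ht
      simp only [Finset.coe_filter, Finset.mem_Icc, Set.mem_ofPred_eq, Finset.mem_coe,
        Finset.mem_powersetCard] at ht ⊢
      refine ⟨⟨Finset.subset_union_right, Finset.union_subset_union_left ht.1⟩, ?_⟩
      rw [Finset.card_union_of_disjoint (h.mono_left ht.1), ht.2]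
      omega
    · intro s hs
      simp only [Finset.coe_filter, Finset.mem_Icc, Set.mem_ofPred_eq] at hs
      exact Finset.sdiff_union_of_subset hs.1.1
    · intro t ht
      simp only [Finset.mem_coe, Finset.mem_powersetCard] at ht
      exact Finset.union_sdiff_cancel_right (h.mono_left ht.1)
  · rw [Finset.card_eq_zero, Finset.filter_eq_empty_iff]
    intro s hs hsa
    have := Finset.card_le_card (Finset.mem_Icc.1 hs).1
    omega

theorem numFaces_union_Icc {X Z : FinComplex V} {α β : Finset V} (hdisj : Disjoint α β)
    (hX : β ∉ X.faces) (hZ : Z.faces = X.faces ∪ Finset.Icc β (α ∪ β)) (a : ℕ) :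
    Z.numFaces a = X.numFaces a + if β.card ≤ a then α.card.choose (a - β.card) else 0 := by
  rw [numFaces, hZ, Finset.filter_union, Finset.card_union_of_disjoint, card_filter_Icc hdisj,
    numFaces]
  refine Finset.disjoint_filter_filter (Finset.disjoint_left.2 fun s hs hs' => hX ?_)
  exact X.down_closed s hs _ (Finset.mem_Icc.1 hs').1

theorem gNumber_union_Icc {X Z : FinComplex V} {α β : Finset V} {d : ℕ} (hdisj : Disjoint α β)
    (hcard : α.card + β.card = d + 2) (hX : β ∉ X.faces)
    (hZ : Z.faces = X.faces ∪ Finset.Icc β (α ∪ β)) (j : ℕ) :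
    Z.gNumber d j = X.gNumber d j + if j = β.card then 1 else 0 := by
  rw [← sum_gNumber_coeff α.card β.card j, gNumber, gNumber, ← Finset.sum_add_distrib]
  refine Finset.sum_congr rfl fun a _ => ?_
  rw [numFaces_union_Icc hdisj hX hZ, hcard]
  push_cast
  ring

end GNumber

/-! ### The weighted g-sum. -/

section AltG

variable {V : Type*}

/-- The weighted alternating sum of the `g`-numbers. -/
def altG (X : FinComplex V) (d l : ℕ) : ℚ :=
  ∑ i ∈ Finset.range (l + 2), (-1 : ℚ) ^ (l + 1 - i) * (weight (d + 2) i * (X.gNumber d i : ℚ))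

/-- The denominator d + 3 of the theorem is the normalisation of the weights on d + 2 elements. -/
theorem altG_eq (X : FinComplex V) (d l : ℕ) :
    X.altG d l = 1 / ((d : ℚ) + 3) * ∑ i ∈ Finset.range (l + 2),
      (-1 : ℚ) ^ (l + 1 - i) * ((X.gNumber d i : ℚ) / ((d + 2).choose i : ℚ)) := by
  rw [altG, Finset.mul_sum]
  refine Finset.sum_congr rfl fun i _ => ?_
  rw [weight, one_div_mul_eq_div, ← div_div]
  push_cast
  ring

end AltG

/-! ### Comparison of the two sides along a bistellar move. -/

section Deficit

variable (F : Type*) [Field F] {V : Type*} [LinearOrder V]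

theorem induced_faces_union_Icc {X Z : FinComplex V} {α β : Finset V}
    (hZ : Z.faces = X.faces ∪ Finset.Icc β (α ∪ β)) {A : Finset V} (hA : β ⊆ A) :
    (Z.induced A).faces = (X.induced A).faces ∪ Finset.Icc β (α ∩ A ∪ β) := by
  ext s
  simp only [induced, hZ, Finset.mem_filter, Finset.mem_union, Finset.mem_Icc]
  constructor
  · rintro ⟨h | ⟨h1, h2⟩, h3⟩
    · exact Or.inl ⟨h, h3⟩
    · refine Or.inr ⟨h1, fun x hx => ?_⟩
      rcases Finset.mem_union.1 (h2 hx) with h | h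
      · exact Finset.mem_union_left _ (Finset.mem_inter.2 ⟨h, h3 hx⟩)
      · exact Finset.mem_union_right _ h
  · rintro (⟨h, h3⟩ | ⟨h1, h2⟩)
    · exact ⟨Or.inl h, h3⟩
    · exact ⟨Or.inr ⟨h1, h2.trans (Finset.union_subset_union_left Finset.inter_subset_left)⟩,
        h2.trans (Finset.union_subset Finset.inter_subset_right hA)⟩

theorem induced_faces_eq_of_not_subset {X Z : FinComplex V} {α β : Finset V}
    (hZ : Z.faces = X.faces ∪ Finset.Icc β (α ∪ β)) {A : Finset V} (hA : ¬ β ⊆ A) :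
    (Z.induced A).faces = (X.induced A).faces := by
  ext s
  simp only [induced, hZ, Finset.mem_filter, Finset.mem_union, Finset.mem_Icc]
  constructor
  · rintro ⟨h | ⟨h1, h2⟩, h3⟩
    · exact ⟨h, h3⟩
    · exact absurd (h1.trans h3) hA
  · exact fun h => ⟨Or.inl h.1, h.2⟩

/-- The effect of adding a Boolean interval on an induced subcomplex that does not meet the
interval in a single face. -/
theorem altBetti_induced_of_ne {X Z : FinComplex V} {α β : Finset V} (hdisj : Disjoint α β)
    (hβ : β.Nonempty) (hX : β ∉ X.faces) (hZ : Z.faces = X.faces ∪ Finset.Icc β (α ∪ β))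
    {A : Finset V} (hA : A ∩ (α ∪ β) ≠ β) (l : ℕ) :
    (Z.induced A).altBetti F l = (X.induced A).altBetti F l := by
  by_cases hβA : β ⊆ A
  · refine altBetti_union_Icc F (α ∩ A) ?_ (hdisj.mono_left Finset.inter_subset_left) hβ
      (fun h => hX (Finset.mem_filter.1 h).1) (induced_faces_union_Icc hZ hβA) l
    -- As β ⊆ A, an empty α ∩ A would force A ∩ (α ∪ β) = β.
    rw [Finset.nonempty_iff_ne_empty]
    intro h
    rw [Finset.inter_union_distrib_left, Finset.inter_comm, h, Finset.empty_union,
      Finset.inter_eq_right.2 hβA] at hA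
    exact hA rfl
  · rw [altBetti_congr F (induced_faces_eq_of_not_subset hZ hβA)]

theorem induced_faces_insert {X Z : FinComplex V} {α β : Finset V} (hdisj : Disjoint α β)
    (hZ : Z.faces = X.faces ∪ Finset.Icc β (α ∪ β))
    {A : Finset V} (hA : A ∩ (α ∪ β) = β) :
    (Z.induced A).faces = insert β (X.induced A).faces := by
  have hβA : β ⊆ A := hA ▸ Finset.inter_subset_left
  have h : α ∩ A = ∅ := by
    rw [Finset.eq_empty_iff_forall_notMem]
    intro x hx
    rw [Finset.mem_inter] at hx
    refine Finset.disjoint_left.1 hdisj hx.1 ?_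
    rw [← hA]
    exact Finset.mem_inter.2 ⟨hx.2, Finset.mem_union_left _ hx.1⟩
  rw [induced_faces_union_Icc hZ hβA, h, Finset.empty_union, Finset.Icc_self, Finset.union_comm,
    Finset.insert_eq]

theorem notMem_induced {X : FinComplex V} {β : Finset V} (hX : β ∉ X.faces) (A : Finset V) :
    β ∉ (X.induced A).faces := fun h => hX (Finset.mem_filter.1 h).1

/-- The weighted average over induced subcomplexes of the alternating sums of reduced Betti
numbers. -/
noncomputable def avgAltBetti (X : FinComplex V) (U : Finset V) (l : ℕ) : ℚ :=
  average U (fun A => ((X.induced A).altBetti F l : ℚ))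

theorem subset_vertices (X : FinComplex V) {s : Finset V} (hs : s ∈ X.faces) : s ⊆ X.vertices :=
  Finset.subset_biUnion_of_mem id hs

theorem induced_inter_vertices (X : FinComplex V) (A : Finset V) :
    X.induced (A ∩ X.vertices) = X.induced A := by
  refine FinComplex.ext (Finset.filter_congr fun s hs => ?_)
  rw [Finset.subset_inter_iff, and_iff_left (X.subset_vertices hs)]

theorem avgAltBetti_of_subset (X : FinComplex V) {U : Finset V} (hU : X.vertices ⊆ U) (l : ℕ) :
    X.avgAltBetti F U l = X.avgAltBetti F X.vertices l :=
  average_of_subset hU fun A => by rw [induced_inter_vertices]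

theorem avgAltBetti_union_Icc_of_le {X Z : FinComplex V} {α β U : Finset V} {l : ℕ}
    (hdisj : Disjoint α β) (hβ : β.Nonempty) (hX : β ∉ X.faces)
    (hZ : Z.faces = X.faces ∪ Finset.Icc β (α ∪ β)) (hU : α ∪ β ⊆ U) (hl : β.card ≤ l + 1) :
    Z.avgAltBetti F U l = X.avgAltBetti F U l +
      (-1) ^ (l + 1 - β.card) * weight (α.card + β.card) β.card := by
  rw [← Finset.card_union_of_disjoint hdisj,
    ← average_indicator hU (Finset.subset_union_right : β ⊆ α ∪ β), avgAltBetti, avgAltBetti,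
    ← average_const_mul, ← average_add]
  refine average_congr fun A _ => ?_
  by_cases hA : A ∩ (α ∪ β) = β
  · rw [altBetti_insert_of_le F (notMem_induced hX A) (induced_faces_insert hdisj hZ hA) hl,
      if_pos hA]
    push_cast
    ring
  · rw [altBetti_induced_of_ne F hdisj hβ hX hZ hA, if_neg hA, mul_zero, add_zero]

theorem avgAltBetti_union_Icc_le {X Z : FinComplex V} {α β U : Finset V} {l : ℕ}
    (hdisj : Disjoint α β) (hβ : β.Nonempty) (hX : β ∉ X.faces)
    (hZ : Z.faces = X.faces ∪ Finset.Icc β (α ∪ β)) (hl : l + 1 < β.card) :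
    Z.avgAltBetti F U l ≤ X.avgAltBetti F U l := by
  refine average_mono fun A _ => ?_
  by_cases hA : A ∩ (α ∪ β) = β
  · have hI := induced_faces_insert hdisj hZ hA
    rcases eq_or_lt_of_le (show l + 2 ≤ β.card from hl) with h | h
    · exact_mod_cast altBetti_insert_le F (notMem_induced hX A) hI h.symm
    · rw [altBetti_insert_of_lt F (notMem_induced hX A) hI h]
  · rw [altBetti_induced_of_ne F hdisj hβ hX hZ hA]

theorem avgAltBetti_union_Icc_of_lt {X Z : FinComplex V} {α β U : Finset V} {l : ℕ}
    (hdisj : Disjoint α β) (hβ : β.Nonempty) (hX : β ∉ X.faces)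
    (hZ : Z.faces = X.faces ∪ Finset.Icc β (α ∪ β)) (hl : l + 2 < β.card) :
    Z.avgAltBetti F U l = X.avgAltBetti F U l := by
  refine average_congr fun A _ => ?_
  by_cases hA : A ∩ (α ∪ β) = β
  · rw [altBetti_insert_of_lt F (notMem_induced hX A) (induced_faces_insert hdisj hZ hA) hl]
  · rw [altBetti_induced_of_ne F hdisj hβ hX hZ hA]

theorem altG_union_Icc {X Z : FinComplex V} {α β : Finset V} {d : ℕ} (hdisj : Disjoint α β)
    (hcard : α.card + β.card = d + 2) (hX : β ∉ X.faces)
    (hZ : Z.faces = X.faces ∪ Finset.Icc β (α ∪ β)) (l : ℕ) :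
    Z.altG d l = X.altG d l +
      if β.card ≤ l + 1 then (-1) ^ (l + 1 - β.card) * weight (d + 2) β.card else 0 := by
  simp only [altG, gNumber_union_Icc hdisj hcard hX hZ, Int.cast_add, mul_add,
    Finset.sum_add_distrib]
  congr 1
  simp [Nat.lt_succ_iff]

/-- The difference of the two sides of the inequality relating the sigma- and the `g`-vector. -/
noncomputable def deficit (X : FinComplex V) (d l : ℕ) : ℚ :=
  X.avgAltBetti F X.vertices l - X.altG d l

theorem deficit_eq (X : FinComplex V) (d : ℕ) {U : Finset V} (hU : X.vertices ⊆ U) (l : ℕ) :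
    X.deficit F d l = X.avgAltBetti F U l - X.altG d l := by
  rw [deficit, avgAltBetti_of_subset F X hU]

theorem vertices_mono {X Z : FinComplex V} (h : X.faces ⊆ Z.faces) : X.vertices ⊆ Z.vertices :=
  Finset.biUnion_subset_biUnion_of_subset_left _ h

/-- Both averages are taken over subsets of `Z.vertices`. The sets A with A ∩ (α ∪ β) = β have total
weight equal to the coefficient of g_j, j = #β, in `altG` up to sign, so the two changes cancel or
are both absent. -/
theorem deficit_union_Icc_eq {X Z : FinComplex V} {α β : Finset V} {d l : ℕ}
    (hdisj : Disjoint α β) (hcard : α.card + β.card = d + 2) (hβ : β.Nonempty)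
    (hX : β ∉ X.faces) (hZ : Z.faces = X.faces ∪ Finset.Icc β (α ∪ β)) (hl : l + 2 ≠ β.card) :
    Z.deficit F d l = X.deficit F d l := by
  have hXZ : X.vertices ⊆ Z.vertices := vertices_mono (by simp [hZ])
  have hU : α ∪ β ⊆ Z.vertices := Z.subset_vertices (by simp [hZ])
  rw [deficit, deficit_eq F X d hXZ, altG_union_Icc hdisj hcard hX hZ]
  split_ifs with h
  · rw [avgAltBetti_union_Icc_of_le F hdisj hβ hX hZ hU h, hcard]
    ring
  · rw [avgAltBetti_union_Icc_of_lt F hdisj hβ hX hZ (by omega), add_zero]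

theorem deficit_union_Icc_le {X Z : FinComplex V} {α β : Finset V} {d l : ℕ}
    (hdisj : Disjoint α β) (hcard : α.card + β.card = d + 2) (hβ : β.Nonempty)
    (hX : β ∉ X.faces) (hZ : Z.faces = X.faces ∪ Finset.Icc β (α ∪ β)) :
    Z.deficit F d l ≤ X.deficit F d l := by
  by_cases hl : l + 2 = β.card
  · have hXZ : X.vertices ⊆ Z.vertices := vertices_mono (by simp [hZ])
    rw [deficit, deficit_eq F X d hXZ, altG_union_Icc hdisj hcard hX hZ, if_neg (by omega),
      add_zero]
    exact sub_le_sub_right (avgAltBetti_union_Icc_le F hdisj hβ hX hZ (by omega)) _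
  · rw [deficit_union_Icc_eq F hdisj hcard hβ hX hZ hl]

/-- The complex of all subsets of `A`. -/
def simplex (A : Finset V) : FinComplex V where
  faces := A.powerset
  empty_mem := Finset.empty_mem_powerset A
  down_closed := by
    intro s hs t hts
    rw [Finset.mem_powerset] at hs ⊢
    exact hts.trans hs

theorem altBetti_simplex_empty (l : ℕ) :
    (simplex (∅ : Finset V)).altBetti F l = (-1) ^ (l + 1) := by
  have hc : (simplex (∅ : Finset V)).chains F (l + 1) = ⊥ := by
    rw [chains, ← Finsupp.supported_empty (M := F) (R := F)]
    congr 1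
    ext s
    simp only [simplex, Finset.powerset_empty, Finset.mem_singleton, Set.mem_ofPred_eq,
      Set.mem_empty_iff_false, iff_false, not_and]
    rintro rfl
    simp
  rw [altBetti, boundaries, hc, Submodule.map_bot, finrank_bot, Finset.sum_eq_single 0]
  · simp [numFaces_zero]
  · intro a _ ha
    have : (simplex (∅ : Finset V)).numFaces a = 0 := by
      simp only [numFaces, simplex, Finset.powerset_empty, Finset.card_eq_zero,
        Finset.filter_eq_empty_iff, Finset.mem_singleton, forall_eq, Finset.card_empty]
      exact ha.symm
    rw [this, Nat.cast_zero, mul_zero]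
  · simp

/-- A new vertex x adds the interval [{x}, A ∪ {x}]. Only the first vertex has an effect, and it
cancels the contribution of the empty face. -/
theorem altBetti_simplex_of_nonempty {A : Finset V} (hA : A.Nonempty) (l : ℕ) :
    (simplex A).altBetti F l = 0 := by
  induction A using Finset.induction_on with
  | empty => simp at hA
  | insert x A hx ih =>
    have hd : Disjoint A {x} := Finset.disjoint_singleton_right.2 hx
    have hX : {x} ∉ (simplex A).faces := by simp [simplex, hx]
    have hZ : (simplex (insert x A)).faces = (simplex A).faces ∪ Finset.Icc {x} (A ∪ {x}) := by
      ext s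
      simp only [simplex, Finset.mem_powerset, Finset.mem_union, Finset.mem_Icc,
        Finset.singleton_subset_iff, Finset.union_comm A, ← Finset.insert_eq]
      constructor
      · intro h
        by_cases hxs : x ∈ s
        · exact Or.inr ⟨hxs, h⟩
        · exact Or.inl ((Finset.subset_insert_iff_of_notMem hxs).1 h)
      · rintro (h | h)
        · exact h.trans (Finset.subset_insert _ _)
        · exact h.2
    rcases A.eq_empty_or_nonempty with rfl | hA'
    · rw [altBetti_insert_of_le F hX (by simpa [Finset.union_comm] using hZ) (by simp),
        altBetti_simplex_empty]
      simp [pow_succ]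
    · rw [altBetti_union_Icc F A hA' hd (Finset.singleton_nonempty x) hX hZ, ih hA']

/-- Only A = ∅ contributes to the average and only g_0 = 1 to the g-sum; both terms are (-1)^(l+1)
times `weight (d + 2) 0`. -/
theorem deficit_of_faces_eq_powerset {X : FinComplex V} {τ : Finset V} {d : ℕ}
    (hτ : τ.card = d + 2) (hX : X.faces = τ.powerset) (l : ℕ) : X.deficit F d l = 0 := by
  have hv : X.vertices = τ := by
    ext x
    simp only [vertices, hX, Finset.mem_biUnion, Finset.mem_powerset, id]
    exact ⟨fun ⟨s, hs, hx⟩ => hs hx, fun hx => ⟨τ, subset_rfl, hx⟩⟩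
  have hI : ∀ A ⊆ τ, X.induced A = simplex A := by
    intro A hA
    ext s
    simp only [induced, simplex, hX, Finset.mem_filter, Finset.mem_powerset]
    exact ⟨fun h => h.2, fun h => ⟨h.trans hA, h⟩⟩
  rw [deficit, hv, sub_eq_zero, avgAltBetti, average, Finset.sum_eq_single ∅, altG,
    Finset.sum_eq_single 0]
  · rw [hI ∅ (Finset.empty_subset _), altBetti_simplex_empty, gNumber_powerset hτ hX, hτ]
    simp [mul_comm]
  · intro i _ hi
    rw [gNumber_powerset hτ hX, if_neg hi]
    simp
  · simp
  · intro A hA hne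
    rw [hI A (Finset.mem_powerset.1 hA),
      altBetti_simplex_of_nonempty F (Finset.nonempty_iff_ne_empty.2 hne)]
    simp
  · simp

/-- A bistellar move passes through the complex in which the simplex on `α ∪ β` is added. -/
theorem IsBistellarMove.exists_cobordism {d i : ℕ} {α β : Finset V} {X Y : FinComplex V}
    (h : IsBistellarMove d i α β X Y) : ∃ Z : FinComplex V,
      Z.faces = X.faces ∪ Finset.Icc β (α ∪ β) ∧ Z.faces = Y.faces ∪ Finset.Icc α (β ∪ α) ∧
      β ∉ X.faces ∧ α ∉ Y.faces := by
  have hdα : ∀ s t : Finset V, s ⊆ α → t ⊆ β → (β ⊆ s ∪ t ↔ β ⊆ t) := fun s t hs _ => by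
    refine ⟨fun hst x hx => ?_, fun h' => h'.trans Finset.subset_union_right⟩
    exact (Finset.mem_union.1 (hst hx)).resolve_left
      fun hxs => Finset.disjoint_left.1 h.disjoint (hs hxs) hx
  have hdβ : ∀ s t : Finset V, s ⊆ α → t ⊆ β → (α ⊆ s ∪ t ↔ α ⊆ s) := fun s t _ ht => by
    refine ⟨fun hst x hx => ?_, fun h' => h'.trans Finset.subset_union_left⟩
    exact (Finset.mem_union.1 (hst hx)).resolve_right
      fun hxt => Finset.disjoint_left.1 h.disjoint hx (ht hxt)
  have hsplit : ∀ s : Finset V, s ⊆ α ∪ β → (s ∩ α) ∪ (s ∩ β) = s := fun s hs => by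
    rw [← Finset.inter_union_distrib_left, Finset.inter_eq_left.2 hs]
  have hJ1 : ∀ s, s ∈ joinFaces α.powerset β.ssubsets ↔ s ⊆ α ∪ β ∧ ¬ β ⊆ s := by
    intro s
    simp only [joinFaces, Finset.mem_image₂, Finset.mem_powerset, Finset.mem_ssubsets]
    constructor
    · rintro ⟨a, ha, b, hb, rfl⟩
      refine ⟨Finset.union_subset_union ha hb.1, fun h' => hb.2 ?_⟩
      exact (hdα a b ha hb.1).1 h'
    · rintro ⟨h1, h2⟩
      refine ⟨s ∩ α, Finset.inter_subset_right, s ∩ β, ⟨Finset.inter_subset_right, fun h' => ?_⟩,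
        hsplit s h1⟩
      exact h2 (h'.trans Finset.inter_subset_left)
  have hJ2 : ∀ s, s ∈ joinFaces α.ssubsets β.powerset ↔ s ⊆ α ∪ β ∧ ¬ α ⊆ s := by
    intro s
    simp only [joinFaces, Finset.mem_image₂, Finset.mem_powerset, Finset.mem_ssubsets]
    constructor
    · rintro ⟨a, ha, b, hb, rfl⟩
      refine ⟨Finset.union_subset_union ha.1 hb, fun h' => ha.2 ?_⟩
      exact (hdβ a b ha.1 hb).1 h'
    · rintro ⟨h1, h2⟩
      refine ⟨s ∩ α, ⟨Finset.inter_subset_right, fun h' => ?_⟩, s ∩ β, Finset.inter_subset_right,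
        hsplit s h1⟩
      exact h2 (h'.trans Finset.inter_subset_left)
  -- The hypothesis on X[α ∪ β] says that, within α ∪ β, exactly the sets containing β are missing.
  have hX : ∀ s, s ⊆ α ∪ β → (s ∈ X.faces ↔ ¬ β ⊆ s) := by
    intro s hs
    have h1 : s ∈ (X.induced (α ∪ β)).faces ↔ s ∈ X.faces := by simp [induced, hs]
    rw [← h1, h.induced_eq, hJ1, and_iff_right hs]
  have hY : ∀ s, s ∈ Y.faces ↔ (s ∈ X.faces ∧ ¬ s ⊆ α ∪ β) ∨ (s ⊆ α ∪ β ∧ ¬ α ⊆ s) := by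
    intro s
    rw [h.faces_eq, Finset.mem_union, Finset.mem_sdiff, hJ1, hJ2]
    have := hX s
    tauto
  refine ⟨⟨X.faces ∪ (α ∪ β).powerset, Finset.mem_union_left _ X.empty_mem, ?_⟩, ?_, ?_, ?_, ?_⟩
  · intro s hs t hts
    rw [Finset.mem_union, Finset.mem_powerset] at hs ⊢
    exact hs.imp (fun h' => X.down_closed s h' t hts) hts.trans
  · ext s
    simp only [Finset.mem_union, Finset.mem_powerset, Finset.mem_Icc]
    have := hX s
    tauto
  · ext s
    simp only [Finset.mem_union, Finset.mem_powerset, Finset.mem_Icc, hY, Finset.union_comm β α]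
    tauto
  · rw [hX β Finset.subset_union_right]
    exact fun h' => h' subset_rfl
  · rw [hY]
    rintro (h' | h')
    · exact h'.2 Finset.subset_union_left
    · exact h'.2 subset_rfl

/-- The relations between Betti numbers of induced subcomplexes and the `g`-vector for stellated
spheres. -/
theorem StellatedIn.deficit_and_gNumber {k d : ℕ} {X : FinComplex V}
    (hX : StellatedIn k d X) :
    (∀ l, l + k + 1 ≤ d → X.deficit F d l ≤ 0 ∧ (k ≤ l + 1 → X.deficit F d l = 0)) ∧
      ∀ j, k < j → j + k ≤ d → X.gNumber d j = 0 := by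
  induction hX with
  | sphere X τ hτ hX =>
    -- The full simplex is its boundary plus the one-element interval [τ, τ], the case α = ∅. Since
    -- #τ = d + 2 exceeds l + 2 and j, neither quantity changes.
    have hd0 : Disjoint (∅ : Finset V) τ := Finset.disjoint_empty_left τ
    have hτ0 : τ.Nonempty := Finset.card_pos.1 (by omega)
    have hτX : τ ∉ X.faces := by simp [hX]
    have hZ : (simplex τ).faces = X.faces ∪ Finset.Icc τ (∅ ∪ τ) := by
      rw [hX, Finset.empty_union, Finset.Icc_self, Finset.union_comm, ← Finset.insert_eq,
        Finset.ssubsets, Finset.insert_erase (Finset.mem_powerset_self τ)]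
      rfl
    constructor
    · intro l hl
      have h0 : X.deficit F d l = 0 := by
        rw [← deficit_union_Icc_eq F hd0 (by simpa using hτ) hτ0 hτX hZ (by omega),
          deficit_of_faces_eq_powerset F hτ rfl]
      exact ⟨h0.le, fun _ => h0⟩
    · intro j hj1 hj2
      have h1 := gNumber_union_Icc hd0 (by simpa using hτ) hτX hZ j
      rw [gNumber_powerset hτ rfl, if_neg (by omega), if_neg (by omega), add_zero] at h1
      exact h1.symm
  | move X Y i α β _ hXY hi ih =>
    obtain ⟨Z, hZX, hZY, hβ, hα⟩ := hXY.exists_cobordism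
    have hc := hXY.card_add_card
    have hc' : β.card + α.card = d + 2 := by omega
    have hi' := hXY.card_right
    have hβ0 : β.Nonempty := Finset.card_pos.1 (by omega)
    constructor
    · intro l hl
      -- Here #α = d + 1 - i ≥ d + 2 - k > l + 2.
      have h1 : Y.deficit F d l = Z.deficit F d l :=
        (deficit_union_Icc_eq F hXY.disjoint.symm hc' hXY.nonempty_left hα hZY (by omega)).symm
      rw [h1]
      refine ⟨(deficit_union_Icc_le F hXY.disjoint hc hβ0 hβ hZX).trans (ih.1 l hl).1,
        fun hkl => ?_⟩
      -- Here #β ≤ k < l + 2.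
      rw [deficit_union_Icc_eq F hXY.disjoint hc hβ0 hβ hZX (by omega)]
      exact (ih.1 l hl).2 hkl
    · intro j hj1 hj2
      have h1 := gNumber_union_Icc hXY.disjoint hc hβ hZX j
      have h2 := gNumber_union_Icc hXY.disjoint.symm hc' hα hZY j
      -- Since #β ≤ k < j ≤ d - k < #α, neither interval affects g_j.
      rw [if_neg (by omega), add_zero] at h1 h2
      rw [← h2, h1, ih.2 j hj1 hj2]

/-- The alternating sums of the sigma-vector as weighted averages. -/
theorem sum_sigma_eq (X : FinComplex V) (l : ℕ) :
    ∑ i ∈ Finset.range (l + 1), (-1 : ℚ) ^ (l - i) * X.sigma F i =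
      ((X.vertices.card : ℚ) + 1) * X.avgAltBetti F X.vertices l := by
  have h1 : ∀ i, X.sigma F i = ((X.vertices.card : ℚ) + 1) *
      average X.vertices (fun A => ((X.induced A).reducedBetti F i : ℚ)) := by
    intro i
    rw [sigma, average, Finset.sum_powerset, Finset.mul_sum]
    refine Finset.sum_congr rfl fun j _ => ?_
    rw [Finset.mul_sum, Finset.mul_sum]
    refine Finset.sum_congr rfl fun A hA => ?_
    rw [(Finset.mem_powersetCard.1 hA).2, weight]
    have : (X.vertices.card : ℚ) + 1 ≠ 0 := by positivity
    field_simp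
  have h2 : X.avgAltBetti F X.vertices l = ∑ i ∈ Finset.range (l + 1), (-1 : ℚ) ^ (l - i) *
      average X.vertices (fun A => ((X.induced A).reducedBetti F i : ℚ)) := by
    simp only [← average_const_mul]
    rw [← average_sum, avgAltBetti]
    refine average_congr fun A _ => ?_
    rw [← sum_reducedBetti_eq_altBetti]
    push_cast
    rfl
  rw [h2, Finset.mul_sum]
  refine Finset.sum_congr rfl fun i _ => ?_
  rw [h1]
  ring

/-- The relations between the sigma- and the `g`-vector that hold for `k`-stellated spheres of
dimension `d`. -/
def SigmaRelations (k d : ℕ) (S : FinComplex V) : Prop :=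
  (∀ i : ℕ, k ≤ i → i + k + 1 ≤ d → S.sigma F i = 0) ∧
  (∀ l : ℕ, l + 2 ≤ k →
    ∑ i ∈ Finset.range (l + 1), (-1 : ℚ) ^ (l - i) * S.sigma F i ≤
      ((S.vertices.card : ℚ) + 1) / ((d : ℚ) + 3) *
        ∑ i ∈ Finset.range (l + 2),
          (-1 : ℚ) ^ (l + 1 - i) * ((S.gNumber d i : ℚ) / ((d + 2).choose i : ℚ))) ∧
  (∀ l : ℕ, k ≤ l + 1 → l + k + 1 ≤ d →
    ∑ i ∈ Finset.range (l + 1), (-1 : ℚ) ^ (l - i) * S.sigma F i =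
      ((S.vertices.card : ℚ) + 1) / ((d : ℚ) + 3) *
        ∑ i ∈ Finset.range (l + 2),
          (-1 : ℚ) ^ (l + 1 - i) * ((S.gNumber d i : ℚ) / ((d + 2).choose i : ℚ)))

theorem StellatedIn.sigmaRelations {k d : ℕ} (hk : 1 ≤ k) (hd : 2 * k ≤ d + 1)
    {S : FinComplex V} (hS : StellatedIn k d S) : S.SigmaRelations F k d := by
  obtain ⟨h1, h2⟩ := hS.deficit_and_gNumber F
  have hG : ∀ l : ℕ, ((S.vertices.card : ℚ) + 1) / ((d : ℚ) + 3) *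
      ∑ i ∈ Finset.range (l + 2),
        (-1 : ℚ) ^ (l + 1 - i) * ((S.gNumber d i : ℚ) / ((d + 2).choose i : ℚ)) =
      ((S.vertices.card : ℚ) + 1) * S.altG d l := fun l => by rw [altG_eq]; ring
  have hm : (0 : ℚ) ≤ (S.vertices.card : ℚ) + 1 := by positivity
  have hc : ∀ l : ℕ, k ≤ l + 1 → l + k + 1 ≤ d →
      ∑ i ∈ Finset.range (l + 1), (-1 : ℚ) ^ (l - i) * S.sigma F i =
        ((S.vertices.card : ℚ) + 1) * S.altG d l := by
    intro l hl1 hl2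
    rw [sum_sigma_eq, sub_eq_zero.1 ((h1 l hl2).2 hl1)]
  refine ⟨fun i hi1 hi2 => ?_, fun l hl => ?_, fun l hl1 hl2 => ?_⟩
  -- σ_i is the sum of the left sides of (c) at l = i - 1 and l = i; on the right only the term with
  -- g_{i+1} survives, and it vanishes.
  · obtain ⟨n, rfl⟩ := Nat.exists_eq_add_of_le' (hk.trans hi1)
    have e1 := hc n (by omega) (by omega)
    have e2 := hc (n + 1) (by omega) (by omega)
    rw [sum_neg_one_pow_succ, e1, altG, altG, sum_neg_one_pow_succ _ (n + 1),
      h2 (n + 2) (by omega) (by omega)] at e2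
    push_cast at e2
    linarith
  · rw [hG, sum_sigma_eq]
    -- The range condition l + k + 1 ≤ d follows from l + 2 ≤ k and 2k ≤ d + 1.
    exact mul_le_mul_of_nonneg_left (sub_nonpos.1 (h1 l (by omega)).1) hm
  · rw [hG, hc l hl1 hl2]

end Deficit

/-! ### Isomorphism invariance of face counts. -/

section Relabel

variable {V W : Type*} [DecidableEq W]

theorem vertices_eq_image [DecidableEq V] {X : FinComplex V} {Y : FinComplex W} {f : V → W}
    (hY : Y.faces = X.faces.image (fun s => s.image f)) : Y.vertices = X.vertices.image f := by
  ext w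
  simp only [vertices, hY, Finset.mem_biUnion, Finset.mem_image, id]
  constructor
  · rintro ⟨_, ⟨s, hs, rfl⟩, hw⟩
    obtain ⟨v, hv, rfl⟩ := Finset.mem_image.1 hw
    exact ⟨v, ⟨s, hs, hv⟩, rfl⟩
  · rintro ⟨v, ⟨s, hs, hv⟩, rfl⟩
    exact ⟨_, ⟨s, hs, rfl⟩, Finset.mem_image_of_mem f hv⟩

variable [DecidableEq V]

theorem injOn_image_faces {X : FinComplex V} {f : V → W}
    (hf : Set.InjOn f (X.vertices : Set V)) :
    Set.InjOn (fun s : Finset V => s.image f) (X.faces : Set (Finset V)) :=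
  (Finset.image_injOn_powerset_of_injOn hf).mono fun _ hs =>
    Finset.mem_coe.2 (Finset.mem_powerset.2 (Finset.subset_biUnion_of_mem id hs))

theorem card_image_of_mem_faces {X : FinComplex V} {f : V → W}
    (hf : Set.InjOn f (X.vertices : Set V)) {s : Finset V} (hs : s ∈ X.faces) :
    (s.image f).card = s.card :=
  Finset.card_image_of_injOn (hf.mono (Finset.coe_subset.2 (Finset.subset_biUnion_of_mem id hs)))

theorem numFaces_relabel {X : FinComplex V} {Y : FinComplex W} {f : V → W}
    (hf : Set.InjOn f (X.vertices : Set V))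
    (hY : Y.faces = X.faces.image (fun s => s.image f)) (a : ℕ) : Y.numFaces a = X.numFaces a := by
  have h : Y.faces.filter (fun s => s.card = a) =
      (X.faces.filter (fun s => s.card = a)).image (fun s => s.image f) := by
    rw [hY, Finset.filter_image]
    congr 1
    exact Finset.filter_congr fun s hs => by rw [card_image_of_mem_faces hf hs]
  rw [numFaces, h, Finset.card_image_of_injOn, numFaces]
  exact (injOn_image_faces hf).mono (Finset.coe_subset.2 (Finset.filter_subset _ _))

theorem gNumber_relabel {X : FinComplex V} {Y : FinComplex W} {f : V → W}
    (hf : Set.InjOn f (X.vertices : Set V))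
    (hY : Y.faces = X.faces.image (fun s => s.image f)) (d j : ℕ) :
    Y.gNumber d j = X.gNumber d j := by
  simp only [gNumber, numFaces_relabel hf hY]

theorem induced_relabel {X : FinComplex V} {Y : FinComplex W} {f : V → W}
    (hf : Set.InjOn f (X.vertices : Set V))
    (hY : Y.faces = X.faces.image (fun s => s.image f)) {A : Finset V} (hA : A ⊆ X.vertices) :
    (Y.induced (A.image f)).faces = (X.induced A).faces.image (fun s => s.image f) := by
  simp only [induced, hY, Finset.filter_image]
  congr 1
  refine Finset.filter_congr fun s hs => ⟨fun h v hv => ?_, fun h => Finset.image_subset_image h⟩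
  obtain ⟨u, hu, huv⟩ := Finset.mem_image.1 (h (Finset.mem_image_of_mem f hv))
  have hvX : v ∈ X.vertices := Finset.subset_biUnion_of_mem id hs hv
  exact hf (hA hu) hvX huv ▸ hu

end Relabel

/-! ### Isomorphism invariance of Betti numbers and the sigma-vector. -/

section RelabelHomology

variable (F : Type*) [Field F] {V W : Type*} [LinearOrder V] [LinearOrder W]

/-- The signs count smaller vertices, so monotonicity of f makes relabelling a chain map without
sign corrections. -/
theorem mapDomain_boundary_single {f : V → W} {s : Finset V}
    (hf : StrictMonoOn f (s : Set V)) :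
    Finsupp.mapDomain (fun t : Finset V => t.image f) (boundary F (Finsupp.single s 1)) =
      boundary F (Finsupp.single (s.image f) 1) := by
  rw [boundary_single, boundary_single, one_smul, one_smul,
    Finset.card_image_of_injOn hf.injOn]
  split_ifs with h
  · exact Finsupp.mapDomain_zero
  · rw [Finsupp.mapDomain_finsetSum, Finset.sum_image hf.injOn]
    refine Finset.sum_congr rfl fun v hv => ?_
    have h1 : (s.erase v).image f = (s.image f).erase (f v) := by
      ext w
      simp only [Finset.mem_image, Finset.mem_erase]
      constructor
      · rintro ⟨u, ⟨hne, hu⟩, rfl⟩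
        exact ⟨fun h => hne (hf.injOn hu hv h), u, hu, rfl⟩
      · rintro ⟨hne, u, hu, rfl⟩
        exact ⟨u, ⟨fun h => hne (h ▸ rfl), hu⟩, rfl⟩
    have h2 : (s.image f).filter (fun w => w < f v) = (s.filter (fun u => u < v)).image f := by
      rw [Finset.filter_image]
      congr 1
      exact Finset.filter_congr fun u hu => hf.lt_iff_lt hu hv
    rw [Finsupp.mapDomain_single, h1, h2, Finset.card_image_of_injOn]
    exact hf.injOn.mono (Finset.coe_subset.2 (Finset.filter_subset _ _))

theorem chains_relabel {X : FinComplex V} {Y : FinComplex W} {f : V → W}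
    (hf : Set.InjOn f (X.vertices : Set V))
    (hY : Y.faces = X.faces.image (fun s => s.image f)) (n : ℕ) :
    Y.chains F n =
      (X.chains F n).map (Finsupp.lmapDomain F F (fun s : Finset V => s.image f)) := by
  rw [chains, chains, Finsupp.lmapDomain_supported]
  congr 1
  ext t
  simp only [hY, Finset.mem_image, Set.mem_ofPred_eq, Set.mem_image]
  constructor
  · rintro ⟨⟨s, hs, rfl⟩, h⟩
    exact ⟨s, ⟨hs, by rwa [card_image_of_mem_faces hf hs] at h⟩, rfl⟩
  · rintro ⟨s, ⟨hs, h⟩, rfl⟩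
    exact ⟨⟨s, hs, rfl⟩, by rwa [card_image_of_mem_faces hf hs]⟩

theorem boundaries_relabel {X : FinComplex V} {Y : FinComplex W} {f : V → W}
    (hf : StrictMonoOn f (X.vertices : Set V))
    (hY : Y.faces = X.faces.image (fun s => s.image f)) (n : ℕ) :
    Y.boundaries F n =
      (X.boundaries F n).map (Finsupp.lmapDomain F F (fun s : Finset V => s.image f)) := by
  rw [boundaries, chains_relabel F hf.injOn hY, boundaries, chains,
    Finsupp.supported_eq_span_single]
  simp only [Submodule.map_span, Set.image_image]
  congr 1
  refine Set.image_congr fun s hs => ?_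
  rw [Finsupp.lmapDomain_apply, Finsupp.lmapDomain_apply, Finsupp.mapDomain_single,
    mapDomain_boundary_single]
  exact hf.mono (Finset.coe_subset.2 (X.subset_vertices hs.1))

theorem finrank_boundaries_relabel {X : FinComplex V} {Y : FinComplex W} {f : V → W}
    (hf : StrictMonoOn f (X.vertices : Set V))
    (hY : Y.faces = X.faces.image (fun s => s.image f)) (n : ℕ) :
    Module.finrank F (Y.boundaries F n) = Module.finrank F (X.boundaries F n) := by
  rw [boundaries_relabel F hf hY, ← LinearMap.range_domRestrict]
  refine LinearMap.finrank_range_of_inj fun c c' h => Subtype.ext ?_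
  have hsupp : ∀ c ∈ X.boundaries F n, (c.support : Set (Finset V)) ⊆ X.faces :=
    fun c hc s hs => ((boundaries_le_cycles F X n hc).1 hs).1
  exact Finsupp.mapDomain_injOn _ (injOn_image_faces hf.injOn) (hsupp c c.2) (hsupp c' c'.2) h

/-- Betti numbers are determined by face numbers and boundary ranks, both preserved. -/
theorem betti_relabel {X : FinComplex V} {Y : FinComplex W} {f : V → W}
    (hf : StrictMonoOn f (X.vertices : Set V))
    (hY : Y.faces = X.faces.image (fun s => s.image f)) (n : ℕ) : Y.betti F n = X.betti F n := by
  have h1 := betti_add_finrank_boundaries F X n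
  have h2 := betti_add_finrank_boundaries F Y n
  rw [finrank_boundaries_relabel F hf hY] at h2
  cases n with
  | zero =>
    rw [finrank_cycles_zero] at h1 h2
    rw [numFaces_relabel hf.injOn hY] at h2
    omega
  | succ n =>
    have h3 := finrank_cycles_succ F X n
    have h4 := finrank_cycles_succ F Y n
    rw [finrank_boundaries_relabel F hf hY, numFaces_relabel hf.injOn hY] at h4
    omega

theorem sigma_relabel {X : FinComplex V} {Y : FinComplex W} {f : V → W}
    (hf : StrictMonoOn f (X.vertices : Set V))
    (hY : Y.faces = X.faces.image (fun s => s.image f)) (i : ℕ) : Y.sigma F i = X.sigma F i := by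
  have hv := vertices_eq_image hY
  have hinj := Finset.image_injOn_powerset_of_injOn hf.injOn
  rw [sigma, sigma, hv, Finset.card_image_of_injOn hf.injOn]
  refine Finset.sum_congr rfl fun j _ => ?_
  congr 1
  symm
  refine Finset.sum_nbij (fun A => A.image f) ?_ ?_ ?_ ?_
  · intro A hA
    obtain ⟨hA, hc⟩ := Finset.mem_powersetCard.1 hA
    refine Finset.mem_powersetCard.2 ⟨Finset.image_subset_image hA, ?_⟩
    rw [Finset.card_image_of_injOn (hf.injOn.mono (Finset.coe_subset.2 hA)), hc]
  · exact hinj.mono fun A hA =>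
      Finset.mem_coe.2 (Finset.mem_powerset.2 (Finset.mem_powersetCard.1 hA).1)
  · intro B hB
    obtain ⟨hB, hc⟩ := Finset.mem_powersetCard.1 hB
    obtain ⟨A, hA, rfl⟩ := Finset.subset_image_iff.1 hB
    refine ⟨A, Finset.mem_coe.2 (Finset.mem_powersetCard.2 ⟨hA, ?_⟩), rfl⟩
    rw [← hc, Finset.card_image_of_injOn (hf.injOn.mono (Finset.coe_subset.2 hA))]
  · intro A hA
    have hA := (Finset.mem_powersetCard.1 hA).1
    have hsub : (X.induced A).vertices ⊆ X.vertices := vertices_mono (Finset.filter_subset _ _)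
    rw [reducedBetti, reducedBetti, betti_relabel F (hf.mono (Finset.coe_subset.2 hsub))
      (induced_relabel hf.injOn hY hA)]

/-- An injective map from a linear order to some type becomes strictly monotone for a suitable
linear order on that type. -/
theorem exists_linearOrder_strictMonoOn {V W : Type*} [LinearOrder V] [DecidableEq W] (f : V → W)
    {T : Set V} (hf : Set.InjOn f T) :
    ∃ L : LinearOrder W, StrictMonoOn f T ∧ L.toDecidableEq = ‹DecidableEq W› := by
  classical
  let _ : LinearOrder W := IsWellOrder.linearOrder WellOrderingRel
  -- The image of T is ordered as in V and placed before all other elements of W.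
  let g : W → Lex (V ⊕ W) := fun w =>
    if h : ∃ v ∈ T, f v = w then toLex (Sum.inl h.choose) else toLex (Sum.inr w)
  have hg1 : ∀ v ∈ T, g (f v) = toLex (Sum.inl v) := by
    intro v hv
    have h : ∃ u ∈ T, f u = f v := ⟨v, hv, rfl⟩
    have := h.choose_spec
    simp only [g, dif_pos h]
    rw [hf this.1 hv this.2]
  have hg2 : ∀ w, (¬ ∃ v ∈ T, f v = w) → g w = toLex (Sum.inr w) := fun w h => dif_neg h
  have hg : Function.Injective g := by
    intro w w' h
    by_cases hw : ∃ v ∈ T, f v = w <;> by_cases hw' : ∃ v ∈ T, f v = w'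
    · obtain ⟨v, hv, rfl⟩ := hw
      obtain ⟨v', hv', rfl⟩ := hw'
      rw [hg1 v hv, hg1 v' hv'] at h
      rw [Sum.inl.inj (toLex.injective h)]
    · obtain ⟨v, hv, rfl⟩ := hw
      rw [hg1 v hv, hg2 w' hw'] at h
      exact absurd (toLex.injective h) (by simp)
    · obtain ⟨v', hv', rfl⟩ := hw'
      rw [hg1 v' hv', hg2 w hw] at h
      exact absurd (toLex.injective h) (by simp)
    · rw [hg2 w hw, hg2 w' hw'] at h
      exact Sum.inr.inj (toLex.injective h)
  refine ⟨LinearOrder.lift' g hg, fun u hu v hv huv => ?_, Subsingleton.elim _ _⟩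
  change g (f u) < g (f v)
  rw [hg1 u hu, hg1 v hv]
  exact Sum.Lex.inl_lt_inl_iff.2 huv

/-- Being stellated does not refer to an order on the vertices. The order on W can therefore be
chosen to make the isomorphism monotone, which avoids proving that Betti numbers are independent of
the vertex order. -/
theorem StellatedIn.sigmaRelations_of_isomorphic {V W : Type*} [LinearOrder V] [DecidableEq W]
    {k d : ℕ} (hk : 1 ≤ k) (hd : 2 * k ≤ d + 1) {S : FinComplex V} {Y : FinComplex W}
    (hY : StellatedIn k d Y) (hSY : S.Isomorphic Y) : S.SigmaRelations F k d := by
  obtain ⟨f, hf, hfaces⟩ := hSY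
  obtain ⟨L, hmono, hL⟩ := exists_linearOrder_strictMonoOn f hf
  subst hL
  have h := hY.sigmaRelations F hk hd
  simp only [SigmaRelations, sigma_relabel F hmono hfaces, gNumber_relabel hf hfaces,
    vertices_eq_image hfaces, Finset.card_image_of_injOn hf] at h
  exact h

end RelabelHomology

end FinComplex

theorem theorem3p5 (F : Type*) [Field F] {V : Type*} [LinearOrder V] (k d m : ℕ)
    (hk : 1 ≤ k) (hd : 2 * k ≤ d + 1) (S : FinComplex V) (hS : S.IsStellated k d)
    (hm : S.vertices.card = m) :
    (∀ i : ℕ, k ≤ i → i + k + 1 ≤ d → S.sigma F i = 0) ∧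
    (∀ l : ℕ, l + 2 ≤ k →
      ∑ i ∈ Finset.range (l + 1), (-1 : ℚ) ^ (l - i) * S.sigma F i ≤
        ((m : ℚ) + 1) / ((d : ℚ) + 3) *
          ∑ i ∈ Finset.range (l + 2),
            (-1 : ℚ) ^ (l + 1 - i) * ((S.gNumber d i : ℚ) / ((d + 2).choose i : ℚ))) ∧
    (∀ l : ℕ, k ≤ l + 1 → l + k + 1 ≤ d →
      ∑ i ∈ Finset.range (l + 1), (-1 : ℚ) ^ (l - i) * S.sigma F i =
        ((m : ℚ) + 1) / ((d : ℚ) + 3) *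
          ∑ i ∈ Finset.range (l + 2),
            (-1 : ℚ) ^ (l + 1 - i) * ((S.gNumber d i : ℚ) / ((d + 2).choose i : ℚ))) := by
  subst hm
  obtain ⟨Y, hY, hSY⟩ := hS
  exact hY.sigmaRelations_of_isomorphic F hk hd hSY
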